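/- Let $d>2$. A convex body in $\mathbb E^d$ is a compact convex set with nonempty interior. A face of a convex body $K$ is a convex subset $F\subseteq K$ such that every segment of $K$ whose relative interior meets $F$ is contained in $F$. A partial flag of $K$ of length $d-s$ is a sequence of faces $F_s\subset F_{s+1}\subset\dots\subset F_{d-1}$ of $K$ with $\dim F_i=i$ for $i=s,\dots,d-1$. Convex bodies $K,K'\subset\mathbb E^d$ are combinatorially equivalent if there is a homeomorphism $h:\operatorname{bd}K\to\operatorname{bd}K'$ such that for every $X\subseteq\operatorname{bd}K$, $X$ is a face of $K$ if and only if $h(X)$ is a face of $K'$. Unit vectors $v_1,\dots,v_k$ (directions) illuminate $K$ if for every $p\in\operatorname{bd}K$ there is an $i$ such that the half-line with endpoint $p$ and direction $v_i$ intersects the interior of $K$. The combinatorial illumination number $I_c(K)$ is the smallest $k$ such that some convex body combinatorially equivalent to $K$ is illuminated by $k$ directions. If $K$ is a convex body in $\mathbb E^d$ whose boundary contains a partial flag of length $d-2$ (that is, faces $F_2\subset\dots\subset F_{d-1}$ with $\dim F_i=i$), then $I_c(K)=d+1$. In particular, $I_c(P)=d+1$ for every convex polytope $P$ in $\mathbb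 E^d$ with nonempty interior. -/

import Mathlib

namespace CombIllum

/-- Euclidean `d`-space. -/
abbrev E (d : ℕ) : Type := EuclideanSpace ℝ (Fin d)

/-- A convex body: a compact convex set with nonempty interior. -/
structure IsConvexBody {d : ℕ} (K : Set (E d)) : Prop where
  convex : Convex ℝ K
  isCompact : IsCompact K
  interior_nonempty : (interior K).Nonempty

/-- A (full-dimensional) convex polytope: a convex body that is the convex hull of finitely
many points. -/
structure IsConvexPolytope {d : ℕ} (P : Set (E d)) : Prop where
  isConvexBody : IsConvexBody P
  exists_finite : ∃ S : Set (E d), S.Finite ∧ P = convexHull ℝ S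

/-- A face of `K`: a convex subset `F` of `K` such that every segment of `K` whose relative
interior meets `F` is contained in `F`. For convex `F` the last condition says that the endpoints
of such a segment lie in `F`, which is Mathlib's `IsExtreme`. -/
structure IsFace {d : ℕ} (K F : Set (E d)) : Prop where
  convex : Convex ℝ F
  isExtreme : IsExtreme ℝ K F

/-- `F` is nonempty and its affine hull has dimension `i`. -/
def HasDim {d : ℕ} (F : Set (E d)) (i : ℕ) : Prop :=
  F.Nonempty ∧ Module.finrank ℝ (vectorSpan ℝ F) = i

/-- A partial flag `F s ⊂ F (s + 1) ⊂ ⋯ ⊂ F (d - 1)` of faces of `K` with `dim (F i) = i`;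
the values of `F` at other indices are irrelevant. Its length is `d - s`. -/
structure IsPartialFlag {d : ℕ} (K : Set (E d)) (s : ℕ) (F : ℕ → Set (E d)) : Prop where
  isFace : ∀ i, s ≤ i → i < d → IsFace K (F i)
  hasDim : ∀ i, s ≤ i → i < d → HasDim (F i) i
  ssubset : ∀ i, s ≤ i → i + 1 < d → F i ⊂ F (i + 1)

/-- The boundary of `K` contains a partial flag of length `m`. -/
def BoundaryContainsPartialFlag {d : ℕ} (K : Set (E d)) (m : ℕ) : Prop :=
  ∃ (s : ℕ) (F : ℕ → Set (E d)), s + m = d ∧ IsPartialFlag K s F ∧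
    ∀ i, s ≤ i → i < d → F i ⊆ frontier K

/-- `K` and `K'` are combinatorially equivalent: there is a homeomorphism between their boundaries
such that a subset of the boundary of `K` is a face of `K` if and only if its image is a face
of `K'`. -/
def CombinatoriallyEquivalent {d : ℕ} (K K' : Set (E d)) : Prop :=
  ∃ h : frontier K ≃ₜ frontier K', ∀ X : Set (frontier K),
    IsFace K (Subtype.val '' X) ↔ IsFace K' (Subtype.val '' (h '' X))

/-- The point `p` (of the boundary of `K`) is illuminated from the direction `v`: the half-line
with endpoint `p` and direction `v` meets the interior of `K`. -/
def IlluminatedFrom {d : ℕ} (K : Set (E d)) (p v : E d) : Prop :=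
  ∃ t : ℝ, 0 ≤ t ∧ p + t • v ∈ interior K

/-- The set `S` of directions (unit vectors) illuminates `K`. -/
def Illuminates {d : ℕ} (S : Finset (E d)) (K : Set (E d)) : Prop :=
  (∀ v ∈ S, ‖v‖ = 1) ∧ ∀ p ∈ frontier K, ∃ v ∈ S, IlluminatedFrom K p v

/-- The combinatorial illumination number of `K`: the smallest `k` such that some convex body
combinatorially equivalent to `K` can be illuminated from `k` directions. (The infimum of the
empty set would be `0`, so a nonzero value is really attained.) -/
noncomputable def combIlluminationNumber {d : ℕ} (K : Set (E d)) : ℕ :=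
  sInf {k : ℕ | ∃ K' : Set (E d), IsConvexBody K' ∧ CombinatoriallyEquivalent K K' ∧
    ∃ S : Finset (E d), S.card = k ∧ Illuminates S K'}

end CombIllum

/-! Lower bound: at most `d` directions lie in a closed half-space `0 ≤ u` with `u ≠ 0`, and a point
of the body where `u` is maximal is illuminated by none of them. This applies to every body, hence
to every combinatorial copy (`lt_card_of_illuminates`).

Upper bound: projective maps that are finite on `K` preserve faces, so it is enough to light a
projective image of `K`. Put `K` at height one in `E d × ℝ`. A projective image of `K` is then
another cross-section of the same cone, given by a functional `l` positive on `K`. `ConeLit` asks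
for such an `l` together with vectors `w`, `l w < 0`, each point of the body being moved into the
relative interior of the cone by some positive multiple of some `w`. Adding a positive multiple of
an interior vector makes `w` parallel to the section without leaving the interior, so `ConeLit`
yields genuine directions (`exists_illuminates_of_coneLit`).

`ConeLit` grows well along flags: one dimension more costs one vector more (`ConeLit.succ`). If `F`
is a facet of `G` and `b ∈ G` lies off `F`, the vectors lighting `F`, tilted slightly towards `b`,
light a neighbourhood of `F` in `G`. One further vector, close to a relatively interior vector of
`F`, lights the rest. The functional is `f` plus a small multiple of the old `l`, where `f` vanishes
on `F`; so the section at infinity is nearly the hyperplane of the facet.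

For a polytope the induction starts at a vertex. For a partial flag it starts at a 2-dimensional
face, which needs three vectors (`coneLit_of_finrank_span_eq_three`). If that face has an edge, the
induction goes through vertex and edge. Otherwise two of its support lines are made parallel by the
choice of `l`, and three explicit vectors work (`coneLit_of_strict`). -/

namespace CombIllum

open Set Filter Topology Submodule

/-- The positive cone `{c • x | 0 < c, x ∈ F}` spanned by `F`. -/
def posCone {X : Type*} [NormedAddCommGroup X] [NormedSpace ℝ X] (F : Set X) : Set X :=
  {y | ∃ c : ℝ, 0 < c ∧ ∃ x ∈ F, y = c • x}

/-- `y` lies in the interior of the positive cone of `F`, relative to its linear span. -/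
def ConeInt {X : Type*} [NormedAddCommGroup X] [NormedSpace ℝ X] (F : Set X) (y : X) : Prop :=
  y ∈ span ℝ F ∧ ∀ᶠ z in 𝓝[(span ℝ F : Set X)] y, z ∈ posCone F

/-! ### Convex cones: relative interior and support. -/

section Cone

variable {X : Type*} [NormedAddCommGroup X] [NormedSpace ℝ X] {F G : Set X} {x y z : X}

theorem subset_posCone : F ⊆ posCone F := fun x hx => ⟨1, one_pos, x, hx, by simp⟩

theorem posCone_mono (h : F ⊆ G) : posCone F ⊆ posCone G :=
  fun _ ⟨c, hc, x, hx, e⟩ => ⟨c, hc, x, h hx, e⟩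

theorem posCone_subset_span : posCone F ⊆ span ℝ F := by
  rintro _ ⟨c, _, x, hx, rfl⟩
  exact smul_mem _ _ (subset_span hx)

theorem smul_mem_posCone {c : ℝ} (hc : 0 < c) (hy : y ∈ posCone F) : c • y ∈ posCone F := by
  obtain ⟨a, ha, x, hx, rfl⟩ := hy
  exact ⟨c * a, mul_pos hc ha, x, hx, by rw [smul_smul]⟩

theorem add_mem_posCone (hF : Convex ℝ F) (hy : y ∈ posCone F) (hz : z ∈ posCone F) :
    y + z ∈ posCone F := by
  obtain ⟨a, ha, x, hx, rfl⟩ := hy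
  obtain ⟨b, hb, x', hx', rfl⟩ := hz
  refine ⟨a + b, add_pos ha hb, (a / (a + b)) • x + (b / (a + b)) • x',
    hF hx hx' (by positivity) (by positivity) (by field_simp), ?_⟩
  rw [smul_add, smul_smul, smul_smul]
  congr 2 <;> field_simp

theorem ConeInt.mem_posCone (h : ConeInt F y) : y ∈ posCone F :=
  h.2.self_of_nhdsWithin h.1

theorem ConeInt.eventually (h : ConeInt F y) : ∀ᶠ z in 𝓝[(span ℝ F : Set X)] y, ConeInt F z := by
  filter_upwards [eventually_eventually_nhdsWithin.2 h.2, self_mem_nhdsWithin] with z h1 h2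
  exact ⟨h2, h1⟩

theorem ConeInt.add (hF : Convex ℝ F) (hy : ConeInt F y) (hz : z ∈ posCone F) :
    ConeInt F (y + z) := by
  have hz' := posCone_subset_span hz
  refine ⟨add_mem hy.1 hz', ?_⟩
  have : Tendsto (fun v => v - z) (𝓝[(span ℝ F : Set X)] (y + z)) (𝓝[(span ℝ F : Set X)] y) := by
    refine tendsto_nhdsWithin_iff.2 ⟨?_, ?_⟩
    · have : ContinuousAt (fun v => v - z) (y + z) := by fun_prop
      have h := this.tendsto
      rw [add_sub_cancel_right] at h
      exact h.mono_left nhdsWithin_le_nhds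
    · filter_upwards [self_mem_nhdsWithin] with v hv
      exact sub_mem hv hz'
  filter_upwards [this.eventually hy.2] with v hv
  simpa using add_mem_posCone hF hv hz

theorem ConeInt.smul {c : ℝ} (hc : 0 < c) (hy : ConeInt F y) : ConeInt F (c • y) := by
  refine ⟨smul_mem _ _ hy.1, ?_⟩
  have : Tendsto (fun v => c⁻¹ • v) (𝓝[(span ℝ F : Set X)] (c • y))
      (𝓝[(span ℝ F : Set X)] y) := by
    refine tendsto_nhdsWithin_iff.2 ⟨?_, ?_⟩
    · have : ContinuousAt (fun v : X => c⁻¹ • v) (c • y) := by fun_prop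
      have h := this.tendsto
      rw [inv_smul_smul₀ hc.ne'] at h
      exact h.mono_left nhdsWithin_le_nhds
    · filter_upwards [self_mem_nhdsWithin] with v hv
      exact smul_mem _ _ hv
  filter_upwards [this.eventually hy.2] with v hv
  simpa [smul_inv_smul₀ hc.ne'] using smul_mem_posCone hc hv

/-- A continuous function with values in the span preserves being in the relative interior. -/
theorem ConeInt.eventually_of_continuousAt {Y : Type*} [TopologicalSpace Y] {φ : Y → X} {a : Y}
    {S : Set Y} (h : ConeInt F (φ a)) (hφ : ContinuousAt φ a)
    (hS : ∀ b ∈ S, φ b ∈ span ℝ F) : ∀ᶠ b in 𝓝 a, b ∈ S → ConeInt F (φ b) := by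
  rw [← eventually_nhdsWithin_iff]
  have : Tendsto φ (𝓝[S] a) (𝓝[(span ℝ F : Set X)] (φ a)) :=
    tendsto_nhdsWithin_iff.2 ⟨hφ.tendsto.mono_left nhdsWithin_le_nhds,
      by filter_upwards [self_mem_nhdsWithin] with b hb using hS b hb⟩
  exact this.eventually h.eventually

theorem eventually_coneInt_add_smul (hg : ConeInt F x) (hy : y ∈ span ℝ F) :
    ∀ᶠ t : ℝ in 𝓝 0, ConeInt F (x + t • y) := by
  have := ConeInt.eventually_of_continuousAt (F := F) (φ := fun t : ℝ => x + t • y) (a := 0)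
    (S := univ) (by simpa using hg) (by fun_prop)
    (fun b _ => add_mem hg.1 (smul_mem _ _ hy))
  simpa using this

/-- A linearly independent family has a family of coordinate functionals on the whole space. -/
theorem exists_coordinates {ι : Type*} [Fintype ι] [DecidableEq ι] {f : ι → X}
    (hf : LinearIndependent ℝ f) :
    ∃ c : ι → X →ₗ[ℝ] ℝ, (∀ i j, c i (f j) = if i = j then 1 else 0) ∧
      ∀ z ∈ span ℝ (range f), z = ∑ i, c i z • f i := by
  have hext := fun i => LinearMap.exists_extend ((Module.Basis.span hf).coord i)
  choose c hc using hext
  have hcz : ∀ i (z : span ℝ (range f)), c i z = (Module.Basis.span hf).coord i z := fun i z => by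
    rw [← hc i]; rfl
  refine ⟨c, fun i j => ?_, fun z hz => ?_⟩
  · have h1 := hcz i (Module.Basis.span hf j)
    rw [Module.Basis.coord_apply, Module.Basis.repr_self, Finsupp.single_apply,
      Module.Basis.span_apply] at h1
    simp [h1, eq_comm]
  · have h1 := congrArg Subtype.val ((Module.Basis.span hf).sum_repr ⟨z, hz⟩)
    rw [AddSubmonoidClass.coe_finsetSum] at h1
    conv_lhs => rw [show z = ((⟨z, hz⟩ : span ℝ (range f)) : X) from rfl, ← h1]
    refine Finset.sum_congr rfl fun i _ => ?_
    have h2 := hcz i ⟨z, hz⟩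
    simp only [Submodule.coe_smul, Module.Basis.span_apply]
    rw [show c i z = _ from h2]; rfl

/-- Choose a basis of the span among the points of `F`. Near `x₀ + ∑ i, f i` the coordinates of `z -
x₀` stay positive, so `z` remains in the cone; rescaling returns the point to `F`. -/
theorem exists_coneInt [FiniteDimensional ℝ X] (hF : Convex ℝ F) (hne : F.Nonempty) :
    ∃ g ∈ F, ConeInt F g := by
  obtain ⟨f, hf, hspan, hli⟩ := exists_fun_fin_finrank_span_eq ℝ F
  obtain ⟨c, hc, hcz⟩ := exists_coordinates hli
  rw [hspan] at hcz
  obtain ⟨x₀, hx₀⟩ := hne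
  have hsum : ∀ a : Fin _ → ℝ, (∀ i, 0 < a i) → x₀ + ∑ i, a i • f i ∈ posCone F := by
    intro a ha
    have : ∀ s : Finset (Fin (Module.finrank ℝ (span ℝ F))),
        x₀ + ∑ i ∈ s, a i • f i ∈ posCone F := by
      intro s
      induction s using Finset.induction_on with
      | empty => simpa using subset_posCone hx₀
      | insert i s hi ih =>
        rw [Finset.sum_insert hi, add_left_comm]
        exact add_mem_posCone hF (smul_mem_posCone (ha i) (subset_posCone (hf i))) ih
    exact this _
  have hint : ConeInt F (x₀ + ∑ i, f i) := by
    refine ⟨add_mem (subset_span hx₀) (sum_mem fun i _ => subset_span (hf i)), ?_⟩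
    have hev : ∀ i, ∀ᶠ z in 𝓝 (x₀ + ∑ i, f i), 0 < c i (z - x₀) := by
      intro i
      have hcont : Continuous fun z => c i (z - x₀) :=
        (LinearMap.continuous_of_finiteDimensional (c i)).comp (continuous_id.sub continuous_const)
      refine hcont.continuousAt.eventually (lt_mem_nhds ?_)
      simp [hc]
    filter_upwards [mem_nhdsWithin_of_mem_nhds (eventually_all.2 hev), self_mem_nhdsWithin]
      with z h1 h2
    have h3 := hcz (z - x₀) (sub_mem h2 (subset_span hx₀))
    have h4 := hsum _ h1
    rwa [← h3, add_sub_cancel] at h4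
  obtain ⟨a, ha, g, hg, h⟩ := hint.mem_posCone
  refine ⟨g, hg, ?_⟩
  have := hint.smul (inv_pos.2 ha)
  rwa [h, inv_smul_smul₀ ha.ne'] at this

/-- In the hyperplane `h = 1`, the cone of `F` meets only `F`. -/
theorem mem_of_mem_posCone {h : X →ₗ[ℝ] ℝ} (hF : ∀ x ∈ F, h x = 1) (hy : y ∈ posCone F)
    (h1 : h y = 1) : y ∈ F := by
  obtain ⟨c, _, x, hx, rfl⟩ := hy
  have : c = 1 := by simpa [hF x hx] using h1
  simpa [this] using hx

/-- A functional which is nonnegative on `F` and vanishes at a point of the relative interior of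
the cone vanishes on the span of `F`. -/
theorem eq_zero_of_coneInt {g : X} (hg : ConeInt F g) {y : X →ₗ[ℝ] ℝ} (hy : ∀ x ∈ F, 0 ≤ y x)
    (h0 : y g = 0) {x : X} (hx : x ∈ span ℝ F) : y x = 0 := by
  have hcone : ∀ z ∈ posCone F, 0 ≤ y z := by
    rintro _ ⟨c, hc, z, hz, rfl⟩
    simpa using mul_nonneg hc.le (hy z hz)
  have key : ∀ x ∈ span ℝ F, 0 ≤ y x := by
    intro x hx
    have := (eventually_coneInt_add_smul hg hx).filter_mono
      (nhdsWithin_le_nhds : 𝓝[>] (0 : ℝ) ≤ 𝓝 0)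
    obtain ⟨t, ht, ht0⟩ := (this.and self_mem_nhdsWithin).exists
    have h2 := hcone _ ht.mem_posCone
    simp only [map_add, map_smul, h0, zero_add, smul_eq_mul] at h2
    exact nonneg_of_mul_nonneg_right h2 ht0
  refine le_antisymm ?_ (key x hx)
  simpa using key (-x) (neg_mem hx)

theorem pos_of_coneInt {g : X} (hg : ConeInt F g) {y : X →ₗ[ℝ] ℝ} (hy : ∀ x ∈ F, 0 ≤ y x)
    {x : X} (hx : x ∈ span ℝ F) (h0 : y x ≠ 0) : 0 < y g := by
  refine lt_of_le_of_ne ?_ fun h => h0 (eq_zero_of_coneInt hg hy h.symm hx)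
  obtain ⟨c, hc, z, hz, rfl⟩ := hg.mem_posCone
  simpa using mul_nonneg hc.le (hy z hz)

/-- If `x ∈ F` and no point `x + t • w` with `t > 0` is in the relative interior of the cone of
`F`, then a supporting functional at `x` is nonpositive at `w`. -/
theorem exists_support [FiniteDimensional ℝ X] (hF : Convex ℝ F) {g x w : X} (hg : ConeInt F g)
    (hx : x ∈ F) (hw : w ∈ span ℝ F) (hun : ∀ t : ℝ, 0 < t → ¬ ConeInt F (x + t • w)) :
    ∃ y : X →ₗ[ℝ] ℝ, (∀ z ∈ F, 0 ≤ y z) ∧ y x = 0 ∧ y w ≤ 0 ∧ 0 < y g := by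
  let O : Set (span ℝ F) := {z | ConeInt F (z : X)}
  have hOopen : IsOpen O := by
    refine isOpen_iff_mem_nhds.2 fun z hz => ?_
    exact (preimage_coe_mem_nhds_subtype (s := (span ℝ F : Set X)) (t := {z | ConeInt F z})).2
      hz.eventually
  have hOconv : Convex ℝ O := by
    rw [convex_iff_forall_pos]
    intro u hu v hv a b ha hb _
    exact ConeInt.add hF (ConeInt.smul ha hu) (ConeInt.smul hb hv).mem_posCone
  let x' : span ℝ F := ⟨x, subset_span hx⟩
  let w' : span ℝ F := ⟨w, hw⟩
  let g' : span ℝ F := ⟨g, hg.1⟩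
  let R : Set (span ℝ F) := (fun t : ℝ => x' + t • w') '' Ioi 0
  have hRconv : Convex ℝ R := by
    rintro _ ⟨s, hs, rfl⟩ _ ⟨t, ht, rfl⟩ a b ha hb hab
    refine ⟨a * s + b * t, convex_Ioi 0 hs ht ha hb hab, ?_⟩
    have : x' = (a + b) • x' := by rw [hab, one_smul]
    simp only
    conv_lhs => rw [this]
    module
  have hdisj : Disjoint O R := by
    rw [Set.disjoint_left]
    rintro _ hO ⟨t, ht, rfl⟩
    exact hun t ht hO
  obtain ⟨f, u, hfO, hfR⟩ := geometric_hahn_banach_open hOconv hOopen hRconv hdisj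
  have hR : ∀ t : ℝ, 0 < t → u ≤ f x' + t * f w' := fun t ht => by
    simpa using hfR _ ⟨t, ht, rfl⟩
  -- `O` is closed under positive scaling, so a linear functional bounded above on it is nonpositive
  -- there.
  have hO : ∀ z ∈ O, f z ≤ 0 := by
    intro z hz
    by_contra! hpos
    have h1 : f ((|u| / f z + 1) • z) < u :=
      hfO _ (ConeInt.smul (c := |u| / f z + 1) (by positivity) hz)
    rw [map_smul, smul_eq_mul, add_mul, div_mul_cancel₀ _ hpos.ne'] at h1
    linarith [le_abs_self u]
  have hu : 0 ≤ u := by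
    by_contra! hneg
    have h2 : Tendsto (fun c : ℝ => c * f g') (𝓝[>] 0) (𝓝 (0 * f g')) :=
      (Continuous.tendsto (by fun_prop) 0).mono_left nhdsWithin_le_nhds
    rw [zero_mul] at h2
    obtain ⟨c, hc, hc0⟩ := ((h2.eventually (lt_mem_nhds hneg)).and self_mem_nhdsWithin).exists
    have h1 := hfO (c • g') (ConeInt.smul (c := c) hc0 hg)
    rw [map_smul, smul_eq_mul] at h1
    linarith
  have hFle : ∀ z (hz : z ∈ F), f ⟨z, subset_span hz⟩ ≤ 0 := by
    intro z hz
    by_contra! hpos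
    have h2 : Tendsto (fun c : ℝ => f ⟨z, subset_span hz⟩ + c * f g') (𝓝[>] 0)
        (𝓝 (f ⟨z, subset_span hz⟩ + 0 * f g')) :=
      (Continuous.tendsto (by fun_prop) 0).mono_left nhdsWithin_le_nhds
    rw [zero_mul, add_zero] at h2
    obtain ⟨c, hc, hc0⟩ := ((h2.eventually (lt_mem_nhds hpos)).and self_mem_nhdsWithin).exists
    have h3 : (c • g' + ⟨z, subset_span hz⟩ : span ℝ F) ∈ O :=
      ConeInt.add hF (ConeInt.smul (c := c) hc0 hg) (subset_posCone hz)
    have h1 := hO _ h3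
    rw [map_add, map_smul, smul_eq_mul] at h1
    linarith
  have hlim : Tendsto (fun t : ℝ => f x' + t * f w') (𝓝[>] 0) (𝓝 (f x' + 0 * f w')) :=
    (Continuous.tendsto (by fun_prop) 0).mono_left nhdsWithin_le_nhds
  have hux : u ≤ f x' := by
    have := ge_of_tendsto hlim (b := u) (by
      filter_upwards [self_mem_nhdsWithin] with t ht using hR t ht)
    simpa using this
  have hfx : f x' = 0 := le_antisymm (hFle x hx) (hu.trans hux)
  have hfw : 0 ≤ f w' := by
    have := hR 1 one_pos
    linarith
  have hfg : f g' < 0 := lt_of_lt_of_le (hfO g' hg) (hux.trans hfx.le)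
  obtain ⟨y, hy⟩ := LinearMap.exists_extend (-(f : span ℝ F →ₗ[ℝ] ℝ))
  have hyz : ∀ z : span ℝ F, y z = - f z := fun z => by
    rw [← Submodule.subtype_apply, ← LinearMap.comp_apply, hy]; rfl
  refine ⟨y, fun z hz => ?_, ?_, ?_, ?_⟩
  · rw [hyz ⟨z, subset_span hz⟩]; linarith [hFle z hz]
  · rw [hyz x', hfx, neg_zero]
  · rw [hyz w']; linarith
  · rw [hyz g']; linarith

end Cone

/-- The cone of `F` can be lit, relative to its span, by `n` vectors lying in an open half-space
whose complementary open half-space contains `F`. -/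
def ConeLit {X : Type*} [NormedAddCommGroup X] [NormedSpace ℝ X] (F : Set X) (n : ℕ) : Prop :=
  ∃ (l : X →ₗ[ℝ] ℝ) (W : Finset X), W.card ≤ n ∧ (∀ x ∈ F, 0 < l x) ∧
    (∀ w ∈ W, w ∈ span ℝ F ∧ l w < 0) ∧
    ∀ x ∈ F, ∃ w ∈ W, ∃ t : ℝ, 0 < t ∧ ConeInt F (x + t • w)

/-! ### Lighting cones and passing from a facet to the whole body. -/

section Lit

variable {X : Type*} [NormedAddCommGroup X] [NormedSpace ℝ X] {F G : Set X} {x y z : X}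

theorem continuous_dual [FiniteDimensional ℝ X] (l : X →ₗ[ℝ] ℝ) : Continuous l :=
  l.continuous_of_finiteDimensional

theorem ConeLit.mono {m n : ℕ} (h : ConeLit F m) (hmn : m ≤ n) : ConeLit F n := by
  obtain ⟨l, W, hW, hrest⟩ := h
  exact ⟨l, W, hW.trans hmn, hrest⟩

/-- A uniform version of a pointwise statement with parameter, on a compact set. -/
theorem eventually_pos_forall {X : Type*} [TopologicalSpace X] {F : Set X} {P : ℝ → X → Prop}
    (hF : IsCompact F)
    (h : ∀ x ∈ F, ∀ᶠ p : ℝ × X in 𝓝 (0, x), p.2 ∈ F → 0 < p.1 → P p.1 p.2) :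
    ∀ᶠ t in 𝓝[>] (0 : ℝ), ∀ x ∈ F, P t x := by
  have := hF.eventually_forall_of_forall_eventually (x₀ := (0 : ℝ))
    (P := fun t x => x ∈ F → 0 < t → P t x) h
  filter_upwards [mem_nhdsWithin_of_mem_nhds this, self_mem_nhdsWithin] with t ht ht0 x hx
  exact ht x hx hx ht0

/-- The strict inequality in `ConeLit` can be relaxed. -/
theorem coneLit_of_nonpos [FiniteDimensional ℝ X] (hF : Convex ℝ F) (hc : IsCompact F)
    (hne : F.Nonempty) (l : X →ₗ[ℝ] ℝ) (W : Finset X) (hl : ∀ x ∈ F, 0 < l x)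
    (hW : ∀ w ∈ W, w ∈ span ℝ F ∧ l w ≤ 0)
    (hlit : ∀ x ∈ F, ∃ w ∈ W, ∃ t : ℝ, 0 < t ∧ ConeInt F (x + t • w)) :
    ConeLit F W.card := by
  classical
  obtain ⟨g, hgF, hg⟩ := exists_coneInt hF hne
  -- Subtracting a small multiple of `g` makes `l` strictly negative on every vector; by compactness
  -- one multiple leaves all of `F` lit.
  have := eventually_pos_forall hc
    (P := fun c x => ∃ w ∈ W, ∃ t : ℝ, 0 < t ∧ ConeInt F (x + t • (w - c • g))) (by
      intro x hx
      obtain ⟨w, hw, t, ht, hi⟩ := hlit x hx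
      have := ConeInt.eventually_of_continuousAt (F := F)
        (φ := fun p : ℝ × X => p.2 + t • (w - p.1 • g)) (a := (0, x)) (S := {p | p.2 ∈ F})
        (by simpa using hi) (by fun_prop) (fun p hp => add_mem (subset_span hp)
          (smul_mem _ _ (sub_mem (hW w hw).1 (smul_mem _ _ hg.1))))
      filter_upwards [this] with p hp h1 _
      exact ⟨w, hw, t, ht, hp h1⟩)
  obtain ⟨c, hc, hc0⟩ := (this.and self_mem_nhdsWithin).exists
  refine ⟨l, W.image (fun w => w - c • g), Finset.card_image_le, hl, ?_, ?_⟩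
  · intro w' hw'
    obtain ⟨w, hw, rfl⟩ := Finset.mem_image.1 hw'
    refine ⟨sub_mem (hW w hw).1 (smul_mem _ _ hg.1), ?_⟩
    have := mul_pos hc0 (hl g hgF)
    simp only [map_sub, map_smul, smul_eq_mul]
    linarith [(hW w hw).2]
  · intro x hx
    obtain ⟨w, hw, t, ht, hi⟩ := hc x hx
    exact ⟨_, Finset.mem_image_of_mem _ hw, t, ht, hi⟩

/-- A point of the span of `G` above the relative interior of the cone of its facet `F` is in the
relative interior of the cone of `G`. -/
theorem coneInt_of_proj [FiniteDimensional ℝ X] (hG : Convex ℝ G) (hFG : F ⊆ G) {f : X →ₗ[ℝ] ℝ}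
    (hfs : ∀ y ∈ span ℝ G, f y = 0 → y ∈ span ℝ F) {b : X} (hb : b ∈ G) (hfb : 0 < f b)
    (hy : y ∈ span ℝ G) (hfy : 0 < f y) (hi : ConeInt F (y - (f y / f b) • b)) : ConeInt G y := by
  refine ⟨hy, ?_⟩
  have hcont : Continuous fun z => z - (f z / f b) • b := by
    have := continuous_dual f
    fun_prop
  have h1 := ConeInt.eventually_of_continuousAt (F := F)
    (φ := fun z => z - (f z / f b) • b) (a := y) (S := span ℝ G) hi hcont.continuousAt (by
      intro z hz
      refine hfs _ (sub_mem hz (smul_mem _ _ (subset_span hb))) ?_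
      rw [map_sub, map_smul, smul_eq_mul, div_mul_cancel₀ _ hfb.ne', sub_self])
  have h2 := (continuous_dual f).continuousAt.eventually (lt_mem_nhds hfy)
  filter_upwards [mem_nhdsWithin_of_mem_nhds h1, mem_nhdsWithin_of_mem_nhds h2,
    self_mem_nhdsWithin] with z hz1 hz2 hz3
  have h3 := posCone_mono hFG (hz1 hz3).mem_posCone
  have h4 := add_mem_posCone hG h3 (smul_mem_posCone (div_pos hz2 hfb) (subset_posCone hb))
  rwa [sub_add_cancel] at h4

/-- If the facet `F = G ∩ ker f` of `G` can be lit by `n` vectors, then `G` can be lit by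
`n + 1` vectors. -/
theorem ConeLit.succ [FiniteDimensional ℝ X] (hF : Convex ℝ F) (hFne : F.Nonempty)
    (hG : Convex ℝ G) (hGc : IsCompact G) (hFG : F ⊆ G) {f : X →ₗ[ℝ] ℝ}
    (hfF : ∀ x ∈ F, f x = 0) (hfG : ∀ x ∈ G, x ∉ F → 0 < f x)
    (hfs : ∀ y ∈ span ℝ G, f y = 0 → y ∈ span ℝ F) {b : X} (hb : b ∈ G) (hbF : b ∉ F) {n : ℕ}
    (h : ConeLit F n) : ConeLit G (n + 1) := by
  classical
  obtain ⟨l, W, hWn, hl, hW, hlit⟩ := h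
  obtain ⟨g, hgF, hg⟩ := exists_coneInt hF hFne
  have hfb : 0 < f b := hfG b hb hbF
  have hf0 : ∀ x ∈ G, 0 ≤ f x := fun x hx => by
    by_cases hxF : x ∈ F
    · exact (hfF x hxF).ge
    · exact (hfG x hx hxF).le
  have hspan : span ℝ F ≤ span ℝ G := span_mono hFG
  have hfspan : ∀ w ∈ span ℝ F, f w = 0 := fun w hw =>
    (span_le (p := LinearMap.ker f)).2 hfF hw
  let π : X → X := fun z => z - (f z / f b) • b
  have hπcont : Continuous π := by
    have := continuous_dual f
    fun_prop
  have hπmem : ∀ z ∈ span ℝ G, π z ∈ span ℝ F := fun z hz => by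
    refine hfs _ (sub_mem hz (smul_mem _ _ (subset_span hb))) ?_
    rw [map_sub, map_smul, smul_eq_mul, div_mul_cancel₀ _ hfb.ne', sub_self]
  have hbG : b ∈ span ℝ G := subset_span hb
  -- The constants are chosen in the order `k`, `e`, `s`. For small `k` each point of `G` is either
  -- lit by `W` after projection along `b` to the span of `F`, or lit by `g - k • b`.
  have hstep1 := eventually_pos_forall hGc
    (P := fun k x => (∃ w ∈ W, ∃ t : ℝ, 0 < t ∧ ConeInt F (π x + t • w)) ∨
      ConeInt G (x + (g - k • b))) (by
      intro x hx
      by_cases hxF : x ∈ F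
      · obtain ⟨w, hw, t, ht, hi⟩ := hlit x hxF
        have := ConeInt.eventually_of_continuousAt (F := F)
          (φ := fun p : ℝ × X => π p.2 + t • w) (a := (0, x)) (S := {p | p.2 ∈ G})
          (by simpa [π, hfF x hxF] using hi) (by fun_prop)
          (fun p hp => add_mem (hπmem _ (subset_span hp)) (smul_mem _ _ (hW w hw).1))
        filter_upwards [this] with p hp h1 _
        exact Or.inl ⟨w, hw, t, ht, hp h1⟩
      · have hfx := hfG x hx hxF
        -- The point `x` itself takes the role of `b`: projecting `x + g` along `x` leaves exactly
        -- `g`.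
        have hi : ConeInt G (x + g) := by
          refine coneInt_of_proj hG hFG hfs hx hfx
            (add_mem (subset_span hx) (hspan hg.1)) (by simpa [hfF g hgF] using hfx) ?_
          simpa [hfF g hgF, hfx.ne'] using hg
        have := ConeInt.eventually_of_continuousAt (F := G)
          (φ := fun p : ℝ × X => p.2 + (g - p.1 • b)) (a := (0, x)) (S := {p | p.2 ∈ G})
          (by simpa using hi) (by fun_prop)
          (fun p hp => add_mem (subset_span hp) (sub_mem (hspan hg.1) (smul_mem _ _ hbG)))
        filter_upwards [this] with p hp h1 _
        exact Or.inr (hp h1))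
  obtain ⟨k, hk, hk0⟩ := (hstep1.and self_mem_nhdsWithin).exists
  have hk0 : 0 < k := hk0
  have hstep2 := eventually_pos_forall hGc (P := fun e x => 0 < e * l x + f x) (by
    intro x hx
    have hlc := continuous_dual l
    have hfc := continuous_dual f
    by_cases hxF : x ∈ F
    · have h1 : ∀ᶠ p : ℝ × X in 𝓝 (0, x), 0 < l p.2 := by
        have : Continuous fun p : ℝ × X => l p.2 := by fun_prop
        exact this.continuousAt.eventually (lt_mem_nhds (hl x hxF))
      filter_upwards [h1] with p hp hpG hp0
      have := mul_pos hp0 hp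
      linarith [hf0 _ hpG]
    · have h1 : ∀ᶠ p : ℝ × X in 𝓝 (0, x), 0 < p.1 * l p.2 + f p.2 := by
        have : Continuous fun p : ℝ × X => p.1 * l p.2 + f p.2 := by fun_prop
        exact this.continuousAt.eventually (lt_mem_nhds (by simpa using hfG x hx hxF))
      filter_upwards [h1] with p hp _ _
      exact hp)
  have hstep3 : ∀ᶠ e in 𝓝[>] (0 : ℝ), e * l g - k * (e * l b + f b) < 0 := by
    have : Continuous fun e : ℝ => e * l g - k * (e * l b + f b) := by fun_prop
    exact mem_nhdsWithin_of_mem_nhds (this.continuousAt.eventually (gt_mem_nhds (by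
      simpa using mul_pos hk0 hfb)))
  obtain ⟨e, ⟨he1, he2⟩, he0⟩ := ((hstep2.and hstep3).and self_mem_nhdsWithin).exists
  have he0 : 0 < e := he0
  -- Since `f` vanishes on `W`, the new functional there is `e * l w < 0`, which leaves room for a
  -- small tilt towards `b`.
  have hstep4 : ∀ᶠ s in 𝓝[>] (0 : ℝ), ∀ w ∈ W, e * l w + s * (e * l b + f b) < 0 := by
    rw [eventually_all_finset]
    intro w hw
    have : Continuous fun s : ℝ => e * l w + s * (e * l b + f b) := by fun_prop
    exact mem_nhdsWithin_of_mem_nhds (this.continuousAt.eventually (gt_mem_nhds (by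
      simpa using mul_neg_of_pos_of_neg he0 (hW w hw).2)))
  obtain ⟨s, hs, hs0⟩ := (hstep4.and self_mem_nhdsWithin).exists
  have hs0 : 0 < s := hs0
  refine ⟨e • l + f, insert (g - k • b) (W.image fun w => w + s • b), ?_, ?_, ?_, ?_⟩
  · exact (Finset.card_insert_le _ _).trans
      (Nat.succ_le_succ (Finset.card_image_le.trans hWn))
  · intro x hx
    simpa using he1 x hx
  · intro w' hw'
    rcases Finset.mem_insert.1 hw' with rfl | hw'
    · refine ⟨sub_mem (hspan hg.1) (smul_mem _ _ hbG), ?_⟩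
      simp only [LinearMap.add_apply, LinearMap.smul_apply, map_sub, map_smul, smul_eq_mul,
        hfF g hgF]
      linarith
    · obtain ⟨w, hw, rfl⟩ := Finset.mem_image.1 hw'
      refine ⟨add_mem (hspan (hW w hw).1) (smul_mem _ _ hbG), ?_⟩
      simp only [LinearMap.add_apply, LinearMap.smul_apply, map_add, map_smul, smul_eq_mul,
        hfspan w (hW w hw).1]
      linarith [hs w hw]
  · intro x hx
    rcases hk x hx with ⟨w, hw, t, ht, hi⟩ | hi
    · refine ⟨w + s • b, Finset.mem_insert_of_mem (Finset.mem_image_of_mem _ hw), t, ht, ?_⟩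
      have hfv : f (x + t • (w + s • b)) = f x + t * s * f b := by
        simp only [map_add, map_smul, smul_eq_mul, hfspan w (hW w hw).1]; ring
      refine coneInt_of_proj hG hFG hfs hb hfb (add_mem (subset_span hx) (smul_mem _ _
        (add_mem (hspan (hW w hw).1) (smul_mem _ _ hbG)))) ?_ ?_
      · rw [hfv]
        have := hf0 x hx
        positivity
      · convert hi using 1
        rw [hfv, add_div, mul_div_assoc, div_self hfb.ne']
        simp only [π]
        module
    · exact ⟨g - k • b, Finset.mem_insert_self _ _, 1, one_pos, by simpa using hi⟩

/-- A face of a convex set contains every point of the set in its span. -/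
theorem mem_of_isExtreme_of_mem_span [FiniteDimensional ℝ X] {h : X →ₗ[ℝ] ℝ}
    (hG1 : ∀ x ∈ G, h x = 1) (hF : Convex ℝ F) (hFne : F.Nonempty) (hext : IsExtreme ℝ G F)
    (hy : y ∈ G) (hys : y ∈ span ℝ F) : y ∈ F := by
  obtain ⟨g, hgF, hg⟩ := exists_coneInt hF hFne
  -- Prolong the segment from `y` to `g` slightly beyond `g`: it stays in `F`, so `g` is an inner
  -- point and extremality puts `y` in `F`.
  have := (eventually_coneInt_add_smul hg (sub_mem hg.1 hys)).filter_mono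
    (nhdsWithin_le_nhds : 𝓝[>] (0 : ℝ) ≤ 𝓝 0)
  obtain ⟨t, ht, ht0⟩ := (this.and self_mem_nhdsWithin).exists
  have ht0 : 0 < t := ht0
  have hgG := hext.subset hgF
  have hz : g + t • (g - y) ∈ F := mem_of_mem_posCone (fun x hx => hG1 x (hext.subset hx))
    ht.mem_posCone (by simp [hG1 g hgG, hG1 y hy])
  refine hext.left_mem_of_mem_openSegment hy (hext.subset hz) hgF ?_
  refine ⟨t / (1 + t), 1 / (1 + t), by positivity, by positivity, by field_simp; ring, ?_⟩
  have : (1 / (1 + t)) • (1 + t) • g = g := by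
    rw [smul_smul]; simp [show (1 + t) ≠ 0 by positivity]
  refine Eq.trans ?_ this
  module

/-- A face of codimension one is cut out by a supporting functional. -/
theorem exists_facet_functional [FiniteDimensional ℝ X] {h : X →ₗ[ℝ] ℝ}
    (hG1 : ∀ x ∈ G, h x = 1) (hF : Convex ℝ F) (hFne : F.Nonempty) (hG : Convex ℝ G)
    (hext : IsExtreme ℝ G F)
    (hdim : Module.finrank ℝ (span ℝ G) = Module.finrank ℝ (span ℝ F) + 1) :
    ∃ f : X →ₗ[ℝ] ℝ, (∀ x ∈ F, f x = 0) ∧ (∀ x ∈ G, x ∉ F → 0 < f x) ∧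
      ∀ y ∈ span ℝ G, f y = 0 → y ∈ span ℝ F := by
  have hspan : span ℝ F ≤ span ℝ G := span_mono hext.subset
  have hne : ∃ b ∈ G, b ∉ span ℝ F := by
    by_contra! hcon
    have := finrank_mono (span_le.2 hcon)
    omega
  obtain ⟨b, hbG, hb⟩ := hne
  obtain ⟨f, hfb, hfF⟩ := Submodule.exists_le_ker_of_notMem hb
  have hfF : ∀ x ∈ span ℝ F, f x = 0 := fun x hx => hfF hx
  have hsup : span ℝ F ⊔ span ℝ {b} = span ℝ G := by
    refine eq_of_le_of_finrank_le
      (sup_le hspan (span_le.2 (singleton_subset_iff.2 (subset_span hbG)))) ?_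
    have hlt : span ℝ F < span ℝ F ⊔ span ℝ {b} := by
      refine lt_of_le_of_ne le_sup_left fun heq => hb ?_
      rw [heq]
      exact mem_sup_right (mem_span_singleton_self b)
    have := finrank_lt_finrank_of_lt hlt
    omega
  have hdec : ∀ y ∈ span ℝ G, f y = 0 → y ∈ span ℝ F := by
    intro y hy hfy
    rw [← hsup] at hy
    obtain ⟨u, hu, v, hv, rfl⟩ := mem_sup.1 hy
    obtain ⟨a, rfl⟩ := mem_span_singleton.1 hv
    have : a * f b = 0 := by simpa [hfF u hu] using hfy
    have ha : a = 0 := by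
      rcases mul_eq_zero.1 this with h | h
      · exact h
      · exact absurd h hfb
    simpa [ha] using hu
  have hmem : ∀ y ∈ G, f y = 0 → y ∈ F := fun y hy h0 =>
    mem_of_isExtreme_of_mem_span hG1 hF hFne hext hy (hdec y (subset_span hy) h0)
  -- A segment with ends strictly on both sides of `f = 0` would cross it in a point of `F`, and
  -- extremality would pull its ends into `F`.
  have hside : ∀ u ∈ G, ∀ v ∈ G, f u < 0 → 0 < f v → False := by
    intro u hu v hv h1 h2
    have hz : (f v / (f v - f u)) • u + (-f u / (f v - f u)) • v ∈ openSegment ℝ u v :=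
      ⟨_, _, div_pos h2 (by linarith), div_pos (by linarith) (by linarith), by
        rw [← add_div]; exact div_self (by linarith), rfl⟩
    have hzF := hmem _ (hG.openSegment_subset hu hv hz) (by
      simp only [map_add, map_smul, smul_eq_mul]; ring)
    exact h1.ne (hfF _ (subset_span (hext.left_mem_of_mem_openSegment hu hv hzF hz)))
  have hne0 : ∀ x ∈ G, x ∉ F → f x ≠ 0 := fun x hx hxF h0 => hxF (hmem x hx h0)
  rcases lt_or_gt_of_ne hfb with hneg | hpos
  · refine ⟨-f, fun x hx => by simp [hfF x (subset_span hx)], fun x hx hxF => ?_,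
      fun y hy h0 => hdec y hy (by simpa using h0)⟩
    have h1 := hne0 x hx hxF
    have h2 := hside b hbG x hx hneg
    have : f x < 0 := lt_of_le_of_ne (not_lt.1 h2) h1
    simpa using this
  · refine ⟨f, fun x hx => hfF x (subset_span hx), fun x hx hxF => ?_, hdec⟩
    have h1 := hne0 x hx hxF
    have h2 := fun hn => hside x hx b hbG hn hpos
    exact lt_of_le_of_ne (not_lt.1 h2) h1.symm

theorem ConeLit.succ_of_isExtreme [FiniteDimensional ℝ X] {h : X →ₗ[ℝ] ℝ}
    (hG1 : ∀ x ∈ G, h x = 1) (hF : Convex ℝ F) (hFne : F.Nonempty) (hG : Convex ℝ G)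
    (hGc : IsCompact G) (hext : IsExtreme ℝ G F)
    (hdim : Module.finrank ℝ (span ℝ G) = Module.finrank ℝ (span ℝ F) + 1) {n : ℕ}
    (hlit : ConeLit F n) : ConeLit G (n + 1) := by
  obtain ⟨f, hf1, hf2, hf3⟩ := exists_facet_functional hG1 hF hFne hG hext hdim
  obtain ⟨b, hb, hbF⟩ : ∃ b ∈ G, b ∉ F := by
    by_contra! hcon
    have := finrank_mono (span_mono (R := ℝ) hcon)
    omega
  exact hlit.succ hF hFne hG hGc hext.subset hf1 hf2 hf3 hb hbF

theorem coneLit_singleton [FiniteDimensional ℝ X] {p : X} {h : X →ₗ[ℝ] ℝ} (hp : h p = 1) :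
    ConeLit {p} 1 := by
  refine ⟨h, {-p}, by simp, by simp [hp], ?_, ?_⟩
  · simp only [Finset.mem_singleton, forall_eq, map_neg, hp]
    exact ⟨neg_mem (subset_span rfl), by norm_num⟩
  · simp only [mem_singleton_iff, Finset.mem_singleton, forall_eq, exists_eq_left]
    refine ⟨1 / 2, by norm_num, ?_, ?_⟩
    · exact add_mem (subset_span rfl) (smul_mem _ _ (neg_mem (subset_span rfl)))
    · have hcont : ContinuousAt h (p + (1 / 2 : ℝ) • -p) := (continuous_dual h).continuousAt
      have hpos : 0 < h (p + (1 / 2 : ℝ) • -p) := by simp [hp]; norm_num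
      filter_upwards [mem_nhdsWithin_of_mem_nhds (hcont.eventually (lt_mem_nhds hpos)),
        self_mem_nhdsWithin] with z hz hzs
      obtain ⟨a, rfl⟩ := mem_span_singleton.1 hzs
      exact ⟨a, by simpa [hp] using hz, p, rfl, rfl⟩

end Lit

/-! ### Three vectors for a planar convex body. -/

section Planar

variable {X : Type*} [NormedAddCommGroup X] [NormedSpace ℝ X] [FiniteDimensional ℝ X] {F : Set X}
  {h : X →ₗ[ℝ] ℝ}

theorem coneLit_of_finrank_span_eq_two (hF1 : ∀ x ∈ F, h x = 1) (hF : Convex ℝ F)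
    (hc : IsCompact F) (hne : F.Nonempty) (hdim : Module.finrank ℝ (span ℝ F) = 2) :
    ConeLit F 2 := by
  obtain ⟨p, hp⟩ := hc.extremePoints_nonempty hne
  have hp1 := hF1 p hp.1
  have hp0 : p ≠ 0 := by rintro rfl; simp at hp1
  exact ConeLit.succ_of_isExtreme hF1 (convex_singleton p) (singleton_nonempty p) hF hc
    (isExtreme_singleton.2 hp) (by rw [finrank_span_singleton hp0, hdim]) (coneLit_singleton hp1)

omit [FiniteDimensional ℝ X] in
theorem isExtreme_inter_ker {u : X →ₗ[ℝ] ℝ} (hu : ∀ x ∈ F, 0 ≤ u x) :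
    IsExtreme ℝ F (F ∩ {x | u x = 0}) := by
  refine ⟨inter_subset_left, ?_⟩
  rintro x hx y hy _ hz ⟨a, b, ha, hb, _, rfl⟩
  have h1 := hz.2
  simp only [mem_ofPred_eq, map_add, map_smul, smul_eq_mul] at h1
  have h2 := mul_nonneg hb.le (hu y hy)
  have h3 := mul_nonneg ha.le (hu x hx)
  have h4 : a * u x = 0 := by linarith
  exact ⟨hx, (mul_eq_zero.1 h4).resolve_left ha.ne'⟩

omit [FiniteDimensional ℝ X] in
theorem convex_inter_ker (hF : Convex ℝ F) (u : X →ₗ[ℝ] ℝ) : Convex ℝ (F ∩ {x | u x = 0}) :=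
  hF.inter (LinearMap.ker u).convex

theorem isCompact_inter_ker (hF : IsCompact F) (u : X →ₗ[ℝ] ℝ) :
    IsCompact (F ∩ {x | u x = 0}) :=
  hF.inter_right (isClosed_eq (continuous_dual u) continuous_const)

/-- The zero set of `u` contains two distinct points but not `g`, so its cone has rank two: it is an
edge, and one more facet step reaches `F`. -/
theorem coneLit_of_edge (hF1 : ∀ x ∈ F, h x = 1) (hF : Convex ℝ F) (hc : IsCompact F)
    (hdim : Module.finrank ℝ (span ℝ F) = 3) {u : X →ₗ[ℝ] ℝ} (hu : ∀ x ∈ F, 0 ≤ u x) {g x y : X}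
    (hg : g ∈ F) (hug : 0 < u g) (hx : x ∈ F) (hy : y ∈ F) (hxy : x ≠ y) (hux : u x = 0)
    (huy : u y = 0) : ConeLit F 3 := by
  have hd2 : Module.finrank ℝ (span ℝ (F ∩ {x | u x = 0})) = 2 := by
    have h1 : span ℝ (F ∩ {x | u x = 0}) < span ℝ F := by
      refine lt_of_le_of_ne (span_mono inter_subset_left) fun heq => hug.ne' ?_
      have h2 : span ℝ (F ∩ {x | u x = 0}) ≤ LinearMap.ker u := span_le.2 fun _ hz => hz.2
      rw [heq] at h2
      exact h2 (subset_span hg)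
    have h3 : span ℝ {x} < span ℝ (F ∩ {x | u x = 0}) := by
      refine lt_of_le_of_ne (span_mono (singleton_subset_iff.2 ⟨hx, hux⟩)) fun heq => hxy ?_
      have h2 : y ∈ span ℝ {x} := by rw [heq]; exact subset_span ⟨hy, huy⟩
      obtain ⟨a, rfl⟩ := mem_span_singleton.1 h2
      have h4 := hF1 _ hy
      rw [map_smul, hF1 x hx, smul_eq_mul, mul_one] at h4
      rw [h4, one_smul]
    have h5 := finrank_lt_finrank_of_lt h1
    have h6 := finrank_lt_finrank_of_lt h3
    have hx1 := hF1 x hx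
    have hx0 : x ≠ 0 := by rintro rfl; simp at hx1
    rw [finrank_span_singleton hx0] at h6
    omega
  have hne : (F ∩ {x | u x = 0}).Nonempty := ⟨x, hx, hux⟩
  exact ConeLit.succ_of_isExtreme hF1 (convex_inter_ker hF u) hne hF hc (isExtreme_inter_ker hu)
    (by rw [hdim, hd2]) (coneLit_of_finrank_span_eq_two (fun x hx => hF1 x hx.1)
      (convex_inter_ker hF u) (isCompact_inter_ker hc u) hne hd2)

/-- By Krein–Milman, extreme points all lying in the closed subspace `V` would force `F` into `V`.
-/
theorem exists_extremePoint_notMem (hF : Convex ℝ F) (hc : IsCompact F) (V : Submodule ℝ X)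
    (hV : Module.finrank ℝ V < Module.finrank ℝ (span ℝ F)) :
    ∃ p ∈ F.extremePoints ℝ, p ∉ V := by
  by_contra! hcon
  have h1 : closure (convexHull ℝ (F.extremePoints ℝ)) ⊆ V :=
    closure_minimal (convexHull_min hcon V.convex) V.closed_of_finiteDimensional
  rw [closure_convexHull_extremePoints hc hF] at h1
  exact absurd (finrank_mono (span_le.2 h1)) (not_le.2 hV)

theorem exists_support_of_mem_extremePoints (hF1 : ∀ x ∈ F, h x = 1) (hF : Convex ℝ F) {g p : X}
    (hgF : g ∈ F) (hg : ConeInt F g) (hp : p ∈ F.extremePoints ℝ) (hpg : p ≠ g) :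
    ∃ y : X →ₗ[ℝ] ℝ, (∀ z ∈ F, 0 ≤ y z) ∧ y p = 0 ∧ 0 < y g := by
  -- The direction `p - g` points out of `F` at `p`: otherwise `p` would be inside a segment of `F`
  -- starting at `g`.
  obtain ⟨y, h1, h2, _, h3⟩ := exists_support hF hg hp.1
    (sub_mem (subset_span hp.1) hg.1) (w := p - g) (by
      intro t ht hi
      have hz : p + t • (p - g) ∈ F := mem_of_mem_posCone hF1 hi.mem_posCone
        (by simp [hF1 p hp.1, hF1 g hgF])
      refine hpg (hp.2 hgF hz ?_).symm
      refine ⟨t / (1 + t), 1 / (1 + t), by positivity, by positivity, by field_simp; ring, ?_⟩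
      have : (1 / (1 + t)) • (1 + t) • p = p := by
        rw [smul_smul]; simp [show (1 + t) ≠ 0 by positivity]
      refine Eq.trans ?_ this
      module)
  exact ⟨y, h1, h2, h3⟩

omit [FiniteDimensional ℝ X] in
/-- Among the functionals supporting `F` at `p` there is one which is extremal with respect to its
value at `q`. -/
theorem exists_extremal_support {g p q : X} (hg : ConeInt F g) (hq : q ∈ F) {a b c : X →ₗ[ℝ] ℝ}
    (hx : ∀ x ∈ F, x = a x • p + b x • q + c x • g) (hbq : b q = 1) (hbg : b g = 0)
    (hsupp : ∃ y : X →ₗ[ℝ] ℝ, (∀ z ∈ F, 0 ≤ y z) ∧ y p = 0 ∧ 0 < y g) :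
    ∃ s : ℝ, 0 ≤ s ∧ (∀ x ∈ F, 0 ≤ s * b x + c x) ∧
      ∀ y : X →ₗ[ℝ] ℝ, (∀ z ∈ F, 0 ≤ y z) → y p = 0 → 0 < y g → y q ≤ s * y g := by
  let S : Set ℝ := {s | 0 ≤ s ∧ ∀ x ∈ F, 0 ≤ s * b x + c x}
  have hmem : ∀ y : X →ₗ[ℝ] ℝ, (∀ z ∈ F, 0 ≤ y z) → y p = 0 → 0 < y g → y q / y g ∈ S := by
    intro y hy hyp hyg
    refine ⟨div_nonneg (hy q hq) hyg.le, fun x hxF => ?_⟩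
    have h1 := hy x hxF
    rw [hx x hxF] at h1
    simp only [map_add, map_smul, smul_eq_mul, hyp, mul_zero, zero_add] at h1
    have h2 : y q / y g * b x + c x = (b x * y q + c x * y g) / y g := by
      field_simp
    rw [h2]
    positivity
  have hne : S.Nonempty := by
    obtain ⟨y, h1, h2, h3⟩ := hsupp
    exact ⟨_, hmem y h1 h2 h3⟩
  -- If `s` were unbounded, `b` would be nonnegative on `F`; as `b g = 0` at a relatively interior
  -- point, `b` would vanish on the span, against `b q = 1`.
  have hbdd : BddAbove S := by
    by_contra hnb
    have hb0 : ∀ x ∈ F, 0 ≤ b x := by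
      intro x hxF
      by_contra! hneg
      refine hnb ⟨c x / (-b x), fun s hs => ?_⟩
      rw [le_div_iff₀ (by linarith)]
      linarith [hs.2 x hxF]
    have := pos_of_coneInt hg hb0 (subset_span hq) (by rw [hbq]; exact one_ne_zero)
    exact this.ne' hbg
  have hclosed : IsClosed S := by
    refine IsClosed.inter isClosed_Ici (s₂ := {s | ∀ x ∈ F, 0 ≤ s * b x + c x}) ?_
    simp only [ofPred_forall]
    exact isClosed_biInter fun x _ => isClosed_le continuous_const (by fun_prop)
  have hs := hclosed.csSup_mem hne hbdd
  refine ⟨sSup S, hs.1, hs.2, fun y h1 h2 h3 => ?_⟩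
  rw [← div_le_iff₀ h3]
  exact le_csSup hbdd (hmem y h1 h2 h3)

/-- Used at the touching points `p` and `q`: the tilt by `e` excludes the support functional that is
extremal there. -/
theorem pos_tilt {e S G : ℝ} (he : 0 < e) (hS : 0 ≤ S) (hSG : S ≤ G) (hG : 0 < G)
    (h : G - S + e * S ≤ 0) : False := by
  have h1 := mul_nonneg he.le hS
  have h2 : e * S = 0 := by linarith
  have h3 := (mul_eq_zero.1 h2).resolve_left he.ne'
  linarith

/-- Used away from `p` and `q`: a tilted vector can fail at `x` only if `V + e * c ≤ 0`, with `V`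
the value at `x` of `u` or `v`. -/
theorem add_mul_nonpos_of_tilt {e z U V c P Q : ℝ} (he : 0 < e) (hz : z < 0) (hV : 0 ≤ V)
    (hU : 0 ≤ U) (hQ : 0 ≤ Q) (hw : -z + e * (Q - P) ≤ 0) (hx : 0 = V * P + U * Q - c * z) :
    V + e * c ≤ 0 := by
  have h1 := mul_nonneg he.le hQ
  have h2 : V * (-z) ≤ V * (e * P) := mul_le_mul_of_nonneg_left (by linarith) hV
  have h3 := mul_nonneg he.le (mul_nonneg hU hQ)
  have h4 : e * (V * P + U * Q - c * z) = 0 := by rw [← hx, mul_zero]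
  have h5 : (V + e * c) * (-z) ≤ 0 := by linarith
  exact nonpos_of_mul_nonpos_left h5 (neg_pos.2 hz)

/-- Take extremal support lines `u = 0` at `p` and `v = 0` at `q`. The functional `u + v` vanishes
at their common point `z`, so in the new section both lines have direction `z` and `F` lies in the
strip between them. Now `z` lights one arc between `p` and `q`, while `-z` tilted to either side
lights the other arc and the two ends. -/
theorem coneLit_of_strict (hF1 : ∀ x ∈ F, h x = 1) (hF : Convex ℝ F) (hc : IsCompact F)
    (hdim : Module.finrank ℝ (span ℝ F) = 3) {g : X} (hgF : g ∈ F) (hg : ConeInt F g)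
    (hstrict : ∀ y : X →ₗ[ℝ] ℝ, (∀ z ∈ F, 0 ≤ y z) → 0 < y g → ∀ x ∈ F, ∀ x' ∈ F,
      y x = 0 → y x' = 0 → x = x') : ConeLit F 3 := by
  classical
  have hg1 := hF1 g hgF
  have hg0 : g ≠ 0 := by rintro rfl; simp at hg1
  obtain ⟨p, hp, hpg⟩ := exists_extremePoint_notMem hF hc (span ℝ {g})
    (by rw [finrank_span_singleton hg0, hdim]; norm_num)
  obtain ⟨q, hq, hqpg⟩ := exists_extremePoint_notMem hF hc (span ℝ (range ![p, g]))
    (by rw [hdim]; exact lt_of_le_of_lt (finrank_range_le_card _) (by simp))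
  have hli2 : LinearIndependent ℝ ![p, g] := by
    refine linearIndependent_finCons.2
      ⟨LinearIndependent.of_subsingleton 0 (by simpa using hg0), ?_⟩
    simpa using hpg
  have hli : LinearIndependent ℝ ![q, p, g] := linearIndependent_finCons.2 ⟨hli2, hqpg⟩
  obtain ⟨C, hC, hCz⟩ := exists_coordinates hli
  have hspan : span ℝ (range ![q, p, g]) = span ℝ F := by
    refine eq_of_le_of_finrank_le (span_le.2 ?_) ?_
    · rintro _ ⟨i, rfl⟩
      fin_cases i
      · exact subset_span hq.1
      · exact subset_span hp.1
      · exact subset_span hgF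
    · rw [finrank_span_eq_card hli, hdim]; simp
  rw [hspan] at hCz
  obtain ⟨b, a, c, rfl⟩ : ∃ b a c, C = ![b, a, c] := ⟨C 0, C 1, C 2, by
    funext i; fin_cases i <;> rfl⟩
  have hbq : b q = 1 := by simpa using hC 0 0
  have hbp : b p = 0 := by simpa using hC 0 1
  have hbg : b g = 0 := by simpa using hC 0 2
  have haq : a q = 0 := by simpa using hC 1 0
  have hap : a p = 1 := by simpa using hC 1 1
  have hag : a g = 0 := by simpa using hC 1 2
  have hcq : c q = 0 := by simpa using hC 2 0
  have hcp : c p = 0 := by simpa using hC 2 1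
  have hcg : c g = 1 := by simpa using hC 2 2
  have hexp : ∀ x ∈ span ℝ F, x = a x • p + b x • q + c x • g := by
    intro x hx
    have h1 := hCz x hx
    simp only [Fin.sum_univ_three, Matrix.cons_val_zero, Matrix.cons_val_one,
      Matrix.cons_val] at h1
    conv_lhs => rw [h1]
    abel
  have hpne : p ≠ g := by rintro rfl; exact hpg (mem_span_singleton_self p)
  have hqne : q ≠ g := by rintro rfl; exact hqpg (subset_span ⟨1, rfl⟩)
  have hpq : p ≠ q := by rintro rfl; exact hqpg (subset_span ⟨0, rfl⟩)
  obtain ⟨s, hs0, hsF, hsmax⟩ := exists_extremal_support hg hq.1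
    (fun x hx => hexp x (subset_span hx)) hbq hbg
    (exists_support_of_mem_extremePoints hF1 hF hgF hg hp hpne)
  obtain ⟨r, hr0, hrF, hrmax⟩ := exists_extremal_support (a := b) (b := a) (c := c) hg hp.1
    (fun x hx => by conv_lhs => rw [hexp x (subset_span hx)]
                    abel) hap hag
    (exists_support_of_mem_extremePoints hF1 hF hgF hg hq hqne)
  -- the two supporting functionals
  let u : X →ₗ[ℝ] ℝ := s • b + c
  let v : X →ₗ[ℝ] ℝ := r • a + c
  have hu : ∀ x, u x = s * b x + c x := fun x => by simp [u]
  have hv : ∀ x, v x = r * a x + c x := fun x => by simp [v]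
  have huF : ∀ x ∈ F, 0 ≤ u x := fun x hx => by rw [hu]; exact hsF x hx
  have hvF : ∀ x ∈ F, 0 ≤ v x := fun x hx => by rw [hv]; exact hrF x hx
  have hup : u p = 0 := by simp [hu, hbp, hcp]
  have hvq : v q = 0 := by simp [hv, haq, hcq]
  have hug : u g = 1 := by simp [hu, hbg, hcg]
  have hvg : v g = 1 := by simp [hv, hag, hcg]
  have hupos : ∀ x ∈ F, x ≠ p → 0 < u x := fun x hx hne =>
    lt_of_le_of_ne (huF x hx) fun h0 =>
      hne (hstrict u huF (by rw [hug]; exact one_pos) x hx p hp.1 h0.symm hup)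
  have hvpos : ∀ x ∈ F, x ≠ q → 0 < v x := fun x hx hne =>
    lt_of_le_of_ne (hvF x hx) fun h0 =>
      hne (hstrict v hvF (by rw [hvg]; exact one_pos) x hx q hq.1 h0.symm hvq)
  have hs : 0 < s := by simpa [hu, hbq, hcq] using hupos q hq.1 hpq.symm
  have hr : 0 < r := by simpa [hv, hap, hcp] using hvpos p hp.1 hpq
  -- The coefficients give `u z = v z = 0`, and `u d = 1`, `v d = -1`; hence `z` and `d` span the
  -- directions of the section `u + v`.
  let z : X := r⁻¹ • p + s⁻¹ • q - g
  let d : X := s⁻¹ • q - r⁻¹ • p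
  have hpS := subset_span (R := ℝ) hp.1
  have hqS := subset_span (R := ℝ) hq.1
  have hzS : z ∈ span ℝ F := sub_mem (add_mem (smul_mem _ _ hpS) (smul_mem _ _ hqS)) hg.1
  have hdS : d ∈ span ℝ F := sub_mem (smul_mem _ _ hqS) (smul_mem _ _ hpS)
  have hlF : ∀ x ∈ F, 0 < u x + v x := by
    intro x hx
    by_cases hxp : x = p
    · have := hvpos x hx (by rw [hxp]; exact hpq)
      linarith [huF x hx]
    · linarith [hupos x hx hxp, hvF x hx]
  have hlz : (u + v) z = 0 := by
    simp only [z, LinearMap.add_apply, map_sub, map_add, map_smul, smul_eq_mul, hup, hug, hvg, hvq,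
      hu q, hv p, hbq, hcq, hap, hcp]
    field_simp
    ring
  have hld : (u + v) d = 0 := by
    simp only [d, LinearMap.add_apply, map_sub, map_smul, smul_eq_mul, hup, hvq,
      hu q, hv p, hbq, hcq, hap, hcp]
    field_simp
    ring
  -- If both tilted vectors fail at `x`, then `v x + e * c x ≤ 0` and `u x + e * c x ≤ 0`; `e` is
  -- chosen so that the sum of the two left sides is positive.
  obtain ⟨e, he, he0⟩ : ∃ e : ℝ, (∀ x ∈ F, 0 < u x + v x + 2 * e * c x) ∧ 0 < e := by
    have := eventually_pos_forall hc (P := fun e x => 0 < u x + v x + 2 * e * c x) (by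
      intro x hx
      have h1 := continuous_dual u
      have h2 := continuous_dual v
      have h3 := continuous_dual c
      have : Continuous fun p : ℝ × X => u p.2 + v p.2 + 2 * p.1 * c p.2 := by fun_prop
      filter_upwards [this.continuousAt.eventually (lt_mem_nhds (by simpa using hlF x hx))]
        with p hp _ _ using hp)
    exact (this.and self_mem_nhdsWithin).exists
  have hdecomp : ∀ (y : X →ₗ[ℝ] ℝ), ∀ x ∈ F,
      y x = v x * (r⁻¹ * y p) + u x * (s⁻¹ * y q) - c x * y z := by
    intro y x hx
    conv_lhs => rw [hexp x (subset_span hx)]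
    simp only [z, map_sub, map_add, map_smul, smul_eq_mul, hu, hv]
    field_simp
    ring
  have hyz : ∀ (y : X →ₗ[ℝ] ℝ), y z = r⁻¹ * y p + s⁻¹ * y q - y g := fun y => by simp [z]
  have hyd : ∀ (y : X →ₗ[ℝ] ℝ), y d = s⁻¹ * y q - r⁻¹ * y p := fun y => by simp [d]
  have hri := inv_pos.2 hr
  have hsi := inv_pos.2 hs
  have key := coneLit_of_nonpos hF hc ⟨g, hgF⟩ (u + v) {z, -z + e • d, -z - e • d}
    (by simpa using hlF) (by
      intro w hw
      simp only [Finset.mem_insert, Finset.mem_singleton] at hw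
      rcases hw with rfl | rfl | rfl
      · exact ⟨hzS, hlz.le⟩
      · exact ⟨add_mem (neg_mem hzS) (smul_mem _ _ hdS),
          by rw [map_add, map_neg, map_smul, hlz, hld]; simp⟩
      · exact ⟨sub_mem (neg_mem hzS) (smul_mem _ _ hdS),
          by rw [map_sub, map_neg, map_smul, hlz, hld]; simp⟩) (by
      intro x hx
      by_contra! hun
      obtain ⟨y₁, h1F, h1x, h1w, h1g⟩ := exists_support hF hg hx hzS (hun z (by simp))
      obtain ⟨y₂, h2F, h2x, h2w, h2g⟩ := exists_support hF hg hx
        (add_mem (neg_mem hzS) (smul_mem _ e hdS)) (hun (-z + e • d) (by simp))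
      obtain ⟨y₃, h3F, h3x, h3w, h3g⟩ := exists_support hF hg hx
        (sub_mem (neg_mem hzS) (smul_mem _ e hdS)) (hun (-z - e • d) (by simp))
      rw [map_add, map_neg, map_smul, smul_eq_mul] at h2w
      rw [map_sub, map_neg, map_smul, smul_eq_mul] at h3w
      by_cases hxp : x = p
      · rw [hxp] at h2x
        have h4 := hsmax y₂ h2F h2x h2g
        have h5 : s⁻¹ * y₂ q ≤ y₂ g := by
          rw [inv_mul_le_iff₀ hs]; exact h4
        rw [hyz, hyd, h2x, mul_zero] at h2w
        exact pos_tilt he0 (mul_nonneg hsi.le (h2F q hq.1)) h5 h2g (by linarith)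
      by_cases hxq : x = q
      · rw [hxq] at h3x
        have h4 := hrmax y₃ h3F h3x h3g
        have h5 : r⁻¹ * y₃ p ≤ y₃ g := by
          rw [inv_mul_le_iff₀ hr]; exact h4
        rw [hyz, hyd, h3x, mul_zero] at h3w
        exact pos_tilt he0 (mul_nonneg hri.le (h3F p hp.1)) h5 h3g (by linarith)
      have hux := hupos x hx hxp
      have hvx := hvpos x hx hxq
      -- a supporting functional at `x` does not vanish at `z`
      have hnz : ∀ y : X →ₗ[ℝ] ℝ, (∀ w ∈ F, 0 ≤ y w) → y x = 0 → 0 < y g → y z ≠ 0 := by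
        intro y hyF hyx hyg h0
        have h4 := hdecomp y x hx
        have h5 := mul_nonneg hri.le (hyF p hp.1)
        have h6 := mul_nonneg hsi.le (hyF q hq.1)
        have h8 : 0 < r⁻¹ * y p + s⁻¹ * y q := by linarith [hyz y]
        rw [h0, hyx] at h4
        rcases h5.lt_or_eq with h9 | h9
        · have := mul_pos hvx h9
          have := mul_nonneg hux.le h6
          linarith
        · have := mul_pos hux (show 0 < s⁻¹ * y q by linarith)
          have := mul_nonneg hvx.le h5
          linarith
      have h1z : y₁ z < 0 := lt_of_le_of_ne h1w (hnz y₁ h1F h1x h1g)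
      -- With `y z ≥ 0 > y₁ z`, a nonnegative combination of `y` and `y₁` would support `F` at `x`
      -- and vanish at `z`.
      have hneg : ∀ y : X →ₗ[ℝ] ℝ, (∀ w ∈ F, 0 ≤ y w) → y x = 0 → 0 < y g → y z < 0 := by
        intro y hyF hyx hyg
        by_contra! hge
        refine hnz (y z • y₁ + (-y₁ z) • y) (fun w hw => ?_) ?_ ?_ ?_
        · simp only [LinearMap.add_apply, LinearMap.smul_apply, smul_eq_mul]
          have := mul_nonneg hge (h1F w hw)
          have := mul_nonneg (neg_pos.2 h1z).le (hyF w hw)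
          linarith
        · simp [h1x, hyx]
        · simp only [LinearMap.add_apply, LinearMap.smul_apply, smul_eq_mul]
          have := mul_nonneg hge h1g.le
          have := mul_pos (neg_pos.2 h1z) hyg
          linarith
        · simp only [LinearMap.add_apply, LinearMap.smul_apply, smul_eq_mul]
          ring
      have h2z := hneg y₂ h2F h2x h2g
      have h3z := hneg y₃ h3F h3x h3g
      have h2d := hdecomp y₂ x hx
      have h3d := hdecomp y₃ x hx
      rw [h2x] at h2d
      rw [h3x] at h3d
      rw [hyd] at h2w h3w
      have h2q := mul_nonneg hsi.le (h2F q hq.1)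
      have h3p := mul_nonneg hri.le (h3F p hp.1)
      have h4 := add_mul_nonpos_of_tilt he0 h2z hvx.le hux.le h2q h2w h2d
      have h5 := add_mul_nonpos_of_tilt (c := c x) (P := s⁻¹ * y₃ q) he0 h3z hux.le hvx.le h3p
        (by linear_combination h3w) (by linear_combination h3d)
      linarith [he x hx])
  exact key.mono (Finset.card_le_three)

/-- Every planar convex body can be lit by three vectors after a suitable projective map. -/
theorem coneLit_of_finrank_span_eq_three (hF1 : ∀ x ∈ F, h x = 1) (hF : Convex ℝ F)
    (hc : IsCompact F) (hne : F.Nonempty) (hdim : Module.finrank ℝ (span ℝ F) = 3) :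
    ConeLit F 3 := by
  obtain ⟨g, hgF, hg⟩ := exists_coneInt hF hne
  by_cases hstrict : ∀ y : X →ₗ[ℝ] ℝ, (∀ z ∈ F, 0 ≤ y z) → 0 < y g → ∀ x ∈ F, ∀ x' ∈ F,
      y x = 0 → y x' = 0 → x = x'
  · exact coneLit_of_strict hF1 hF hc hdim hgF hg hstrict
  · push Not at hstrict
    obtain ⟨u, hu, hug, x, hx, y, hy, hux, huy, hxy⟩ := hstrict
    exact coneLit_of_edge hF1 hF hc hdim hu hgF hug hx hy hxy hux huy

end Planar

/-! ### Facets of polytopes and induction on dimension. -/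

section Polytope

variable {X : Type*} [NormedAddCommGroup X] [NormedSpace ℝ X] {S : Set X} {h : X →ₗ[ℝ] ℝ}

theorem span_convexHull_eq (S : Set X) : span ℝ (convexHull ℝ S) = span ℝ S :=
  le_antisymm (span_le.2 (convexHull_min subset_span (span ℝ S).convex))
    (span_mono (subset_convexHull ℝ S))

theorem convexHull_inter_ker {u : X →ₗ[ℝ] ℝ} (hu : ∀ x ∈ S, 0 ≤ u x) :
    convexHull ℝ S ∩ {x | u x = 0} = convexHull ℝ (S ∩ {x | u x = 0}) := by
  refine Subset.antisymm ?_ (convexHull_min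
    (fun x hx => ⟨subset_convexHull ℝ S hx.1, hx.2⟩) (convex_inter_ker (convex_convexHull ℝ S) u))
  rintro y ⟨hy, hy0 : u y = 0⟩
  have hS : S = (S ∩ {x | u x = 0}) ∪ (S ∩ {x | 0 < u x}) := by
    ext x
    constructor
    · intro hx
      rcases (hu x hx).eq_or_lt with h0 | h0
      · exact Or.inl ⟨hx, h0.symm⟩
      · exact Or.inr ⟨hx, h0⟩
    · rintro (hx | hx) <;> exact hx.1
  have hpos : ∀ z ∈ convexHull ℝ (S ∩ {x | 0 < u x}), 0 < u z := fun z hz =>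
    convexHull_min (fun x hx => hx.2) ((convex_Ioi (0 : ℝ)).linear_preimage u) hz
  rcases (S ∩ {x | 0 < u x}).eq_empty_or_nonempty with hB | hB
  · rw [hB, union_empty] at hS
    rwa [← hS]
  rcases (S ∩ {x | u x = 0}).eq_empty_or_nonempty with hA | hA
  · rw [hA, empty_union] at hS
    rw [hS] at hy
    exact absurd hy0 (hpos y hy).ne'
  rw [hS, convexHull_union hA hB, mem_convexJoin] at hy
  obtain ⟨a, ha, b, hb, s, t, hs, ht, hst, rfl⟩ := hy
  have ha0 : u a = 0 :=
    (convexHull_min (fun x hx => hx.2) (LinearMap.ker u).convex ha : a ∈ LinearMap.ker u)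
  have ht0 : t = 0 := by
    have h1 : t * u b = 0 := by simpa [ha0] using hy0
    exact (mul_eq_zero.1 h1).resolve_right (hpos b hb).ne'
  have hs1 : s = 1 := by linarith
  simpa [ht0, hs1] using ha

/-- Among supporting functionals not identically zero on `S`, one whose zero set has maximal rank
defines a facet; otherwise it could be rotated about that zero set until it meets a further point of
`S`. -/
theorem exists_facet_of_finite [FiniteDimensional ℝ X] (hS : S.Finite) (hne : S.Nonempty)
    (hS1 : ∀ x ∈ S, h x = 1) :
    ∃ u : X →ₗ[ℝ] ℝ, (∀ x ∈ S, 0 ≤ u x) ∧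
      Module.finrank ℝ (span ℝ S) = Module.finrank ℝ (span ℝ (S ∩ {x | u x = 0})) + 1 := by
  let T : Set ℕ := {m | ∃ u : X →ₗ[ℝ] ℝ, (∀ x ∈ S, 0 ≤ u x) ∧ (∃ x ∈ S, 0 < u x) ∧
    Module.finrank ℝ (span ℝ (S ∩ {x | u x = 0})) = m}
  have hTne : T.Nonempty := by
    obtain ⟨x, hx⟩ := hne
    exact ⟨_, h, fun x hx => by simp [hS1 x hx], ⟨x, hx, by simp [hS1 x hx]⟩, rfl⟩
  have hTb : BddAbove T := ⟨Module.finrank ℝ X, by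
    rintro _ ⟨u, _, _, rfl⟩; exact Submodule.finrank_le _⟩
  obtain ⟨u, hu, ⟨s₀, hs₀, hus₀⟩, hmax⟩ := Nat.sSup_mem hTne hTb
  refine ⟨u, hu, ?_⟩
  let V := span ℝ (S ∩ {x | u x = 0})
  have hVu : ∀ x ∈ V, u x = 0 := fun x hx =>
    (span_le (p := LinearMap.ker u)).2 (fun y hy => hy.2) hx
  have hVS : V ≤ span ℝ S := span_mono inter_subset_left
  have hs₀V : s₀ ∉ V := fun hmem => hus₀.ne' (hVu _ hmem)
  by_contra hcon
  have hsup : ¬ (S ⊆ (V ⊔ span ℝ {s₀} : Submodule ℝ X)) := by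
    intro hsub
    have h1 : V ⊔ span ℝ {s₀} = span ℝ S := le_antisymm
      (sup_le hVS (span_mono (singleton_subset_iff.2 hs₀))) (span_le.2 hsub)
    have h2 : s₀ ≠ 0 := by rintro rfl; exact hs₀V (zero_mem _)
    have h3 := Submodule.finrank_add_le_finrank_add_finrank V (span ℝ {s₀})
    rw [h1, finrank_span_singleton h2] at h3
    have h4 : V < span ℝ S := lt_of_le_of_ne hVS fun heq => hs₀V (heq ▸ subset_span hs₀)
    have h5 := finrank_lt_finrank_of_lt h4
    exact hcon (le_antisymm h3 h5)
  obtain ⟨s₁, hs₁, hs₁V⟩ := not_subset.1 hsup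
  obtain ⟨v, hv₁, hv⟩ : ∃ v : X →ₗ[ℝ] ℝ, v s₁ < 0 ∧ ∀ x ∈ V ⊔ span ℝ {s₀}, v x = 0 := by
    obtain ⟨v, hv₁, hv⟩ := Submodule.exists_le_ker_of_notMem hs₁V
    have hv : ∀ x ∈ V ⊔ span ℝ {s₀}, v x = 0 := fun x hx => hv hx
    rcases lt_or_gt_of_ne hv₁ with hneg | hpos
    · exact ⟨v, hneg, hv⟩
    · exact ⟨-v, by simpa using hpos, fun x hx => by simp [hv x hx]⟩
  -- The smallest ratio is the first moment of the rotation `u + t • v` at which a point of `S` is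
  -- reached. As `v s₀ = 0`, the functional stays nonzero.
  obtain ⟨s₂, ⟨hs₂, hvs₂ : v s₂ < 0⟩, hmin⟩ := Set.exists_min_image (S ∩ {x | v x < 0})
    (fun x => u x / (-v x)) (hS.inter_of_left _) ⟨s₁, hs₁, hv₁⟩
  set t := u s₂ / (-v s₂) with ht
  have ht0 : 0 ≤ t := div_nonneg (hu _ hs₂) (by linarith)
  have hu'S : ∀ x ∈ S, 0 ≤ (u + t • v) x := by
    intro x hx
    simp only [LinearMap.add_apply, LinearMap.smul_apply, smul_eq_mul]
    rcases lt_or_ge (v x) 0 with hneg | hge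
    · have h1 := hmin x ⟨hx, hneg⟩
      rw [le_div_iff₀ (by linarith)] at h1
      linarith
    · exact add_nonneg (hu x hx) (mul_nonneg ht0 hge)
  have hu's₂ : (u + t • v) s₂ = 0 := by
    simp only [LinearMap.add_apply, LinearMap.smul_apply, smul_eq_mul, ht]
    have := hvs₂.ne
    field_simp
    ring
  have hu's₀ : 0 < (u + t • v) s₀ := by
    simpa [hv s₀ (mem_sup_right (mem_span_singleton_self s₀))] using hus₀
  have hlt : V < span ℝ (S ∩ {x | (u + t • v) x = 0}) := by
    refine lt_of_le_of_ne (span_mono fun x hx => ⟨hx.1, ?_⟩) fun heq => hvs₂.ne ?_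
    · have h1 : u x = 0 := hx.2
      simp [h1, hv x (mem_sup_left (subset_span hx))]
    · refine hv s₂ (mem_sup_left ?_)
      rw [heq]
      exact subset_span ⟨hs₂, hu's₂⟩
  have h1 := finrank_lt_finrank_of_lt hlt
  have h2 := le_csSup hTb (⟨u + t • v, hu'S, ⟨s₀, hs₀, hu's₀⟩, rfl⟩ :
    Module.finrank ℝ (span ℝ (S ∩ {x | (u + t • v) x = 0})) ∈ T)
  rw [← hmax] at h2
  exact absurd h1 (not_lt.2 h2)

theorem coneLit_convexHull [FiniteDimensional ℝ X] (n : ℕ) (hS : S.Finite)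
    (hS1 : ∀ x ∈ S, h x = 1) (hdim : Module.finrank ℝ (span ℝ S) = n + 1) :
    ConeLit (convexHull ℝ S) (n + 1) := by
  induction n generalizing S with
  | zero =>
    have hne : S.Nonempty := by
      by_contra hempty
      rw [not_nonempty_iff_eq_empty.1 hempty, span_empty, finrank_bot] at hdim
      omega
    obtain ⟨s, hs⟩ := hne
    have hs0 : s ≠ 0 := by rintro rfl; simpa using hS1 0 hs
    have h1 : span ℝ {s} = span ℝ S := eq_of_le_of_finrank_eq
      (span_mono (singleton_subset_iff.2 hs)) (by rw [finrank_span_singleton hs0, hdim])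
    have h2 : S = {s} := by
      refine Subset.antisymm (fun x hx => ?_) (singleton_subset_iff.2 hs)
      have h3 : x ∈ span ℝ {s} := h1 ▸ subset_span hx
      obtain ⟨a, rfl⟩ := mem_span_singleton.1 h3
      have h4 := hS1 _ hx
      rw [map_smul, hS1 s hs, smul_eq_mul, mul_one] at h4
      simp [h4]
    rw [h2, convexHull_singleton]
    exact coneLit_singleton (hS1 s hs)
  | succ n ih =>
    have hne : S.Nonempty := by
      by_contra hempty
      rw [not_nonempty_iff_eq_empty.1 hempty, span_empty, finrank_bot] at hdim
      omega
    obtain ⟨u, hu, hfr⟩ := exists_facet_of_finite hS hne hS1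
    have hdim' : Module.finrank ℝ (span ℝ (S ∩ {x | u x = 0})) = n + 1 := by omega
    have hlit := ih (hS.inter_of_left _) (fun x hx => hS1 x hx.1) hdim'
    have hne' : (S ∩ {x | u x = 0}).Nonempty := by
      by_contra hempty
      rw [not_nonempty_iff_eq_empty.1 hempty, span_empty, finrank_bot] at hdim'
      omega
    refine ConeLit.succ_of_isExtreme (h := h) (F := convexHull ℝ (S ∩ {x | u x = 0}))
      (fun x hx => ?_) (convex_convexHull ℝ _) (hne'.mono (subset_convexHull ℝ _))
      (convex_convexHull ℝ S) (hS.isCompact_convexHull ℝ) ?_ ?_ hlit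
    · exact convexHull_min (t := {x | h x = 1}) hS1
        ((convex_singleton (1 : ℝ)).linear_preimage h) hx
    · rw [← convexHull_inter_ker hu]
      exact isExtreme_inter_ker fun x hx =>
        convexHull_min (t := {x | 0 ≤ u x}) hu ((convex_Ici (0 : ℝ)).linear_preimage u) hx
    · rw [span_convexHull_eq, span_convexHull_eq, hdim, hdim']

end Polytope

/-! ### Placing bodies at height one. -/

section Homogenization

variable {d : ℕ}

/-- The embedding of Euclidean space as the hyperplane at height one. -/
def hom (x : E d) : E d × ℝ := (x, 1)

@[simp] theorem hom_fst (x : E d) : (hom x).1 = x := rfl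

@[simp] theorem hom_snd (x : E d) : (hom x).2 = 1 := rfl

theorem continuous_hom : Continuous (hom (d := d)) := by unfold hom; fun_prop

/-- `hom` as an affine map. -/
noncomputable def homAffine (d : ℕ) : E d →ᵃ[ℝ] E d × ℝ :=
  (LinearMap.inl ℝ (E d) ℝ).toAffineMap + AffineMap.const ℝ (E d) (0, 1)

theorem coe_homAffine : ⇑(homAffine d) = hom := by
  funext x
  simp [homAffine, hom]

theorem convex_hom_image {F : Set (E d)} (hF : Convex ℝ F) : Convex ℝ (hom '' F) := by
  rw [← coe_homAffine]
  exact hF.affine_image _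

theorem hom_image_convexHull (S : Set (E d)) : hom '' convexHull ℝ S = convexHull ℝ (hom '' S) := by
  rw [← coe_homAffine]
  exact AffineMap.image_convexHull _ _

theorem snd_hom_image {F : Set (E d)} : ∀ x ∈ hom '' F, LinearMap.snd ℝ (E d) ℝ x = 1 := by
  rintro _ ⟨x, _, rfl⟩
  rfl

theorem isExtreme_hom_image {F G : Set (E d)} (h : IsExtreme ℝ G F) :
    IsExtreme ℝ (hom '' G) (hom '' F) := by
  refine ⟨image_mono h.subset, ?_⟩
  rintro _ ⟨x, hx, rfl⟩ _ ⟨y, hy, rfl⟩ _ ⟨z, hz, rfl⟩ ⟨a, b, ha, hb, hab, hz'⟩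
  refine ⟨x, h.left_mem_of_mem_openSegment hx hy hz ⟨a, b, ha, hb, hab, ?_⟩, rfl⟩
  simpa using congrArg Prod.fst hz'

theorem finrank_span_hom_image {F : Set (E d)} (hF : F.Nonempty) :
    Module.finrank ℝ (span ℝ (hom '' F)) = Module.finrank ℝ (vectorSpan ℝ F) + 1 := by
  obtain ⟨x₀, hx₀⟩ := hF
  have hinj : Function.Injective (LinearMap.inl ℝ (E d) ℝ) := LinearMap.inl_injective
  have hne : hom x₀ ≠ 0 := fun h => one_ne_zero (α := ℝ) (congrArg Prod.snd h)
  have hspan : span ℝ (hom '' F) =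
      (vectorSpan ℝ F).map (LinearMap.inl ℝ (E d) ℝ) ⊔ span ℝ {hom x₀} := by
    rw [vectorSpan_eq_span_vsub_set_right ℝ hx₀, Submodule.map_span]
    refine le_antisymm (span_le.2 ?_) (sup_le (span_le.2 ?_)
      (span_mono (singleton_subset_iff.2 ⟨x₀, hx₀, rfl⟩)))
    · rintro _ ⟨x, hx, rfl⟩
      have : hom x = LinearMap.inl ℝ (E d) ℝ (x -ᵥ x₀) + hom x₀ := by
        ext <;> simp [hom]
      rw [this]
      exact add_mem (mem_sup_left (subset_span ⟨_, ⟨x, hx, rfl⟩, rfl⟩))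
        (mem_sup_right (mem_span_singleton_self _))
    · rintro _ ⟨_, ⟨x, hx, rfl⟩, rfl⟩
      have : LinearMap.inl ℝ (E d) ℝ (x -ᵥ x₀) = hom x - hom x₀ := by
        ext <;> simp [hom]
      simp only [this]
      exact sub_mem (subset_span ⟨x, hx, rfl⟩) (subset_span ⟨x₀, hx₀, rfl⟩)
  have hinf : (vectorSpan ℝ F).map (LinearMap.inl ℝ (E d) ℝ) ⊓ span ℝ {hom x₀} = ⊥ := by
    rw [eq_bot_iff]
    rintro z ⟨hz1, hz2⟩
    obtain ⟨a, _, rfl⟩ := hz1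
    obtain ⟨c, hc⟩ := mem_span_singleton.1 hz2
    have hc0 : c = 0 := by simpa using congrArg Prod.snd hc
    rw [hc0, zero_smul] at hc
    rw [← hc]
    exact zero_mem _
  have h1 := Submodule.finrank_sup_add_finrank_inf_eq
    ((vectorSpan ℝ F).map (LinearMap.inl ℝ (E d) ℝ)) (span ℝ {hom x₀})
  rw [hinf, finrank_bot, finrank_span_singleton hne, ← hspan] at h1
  rw [← (Submodule.equivMapOfInjective _ hinj (vectorSpan ℝ F)).finrank_eq] at h1
  simpa using h1

theorem IsConvexBody.finrank_vectorSpan {K : Set (E d)} (hK : IsConvexBody K) :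
    Module.finrank ℝ (vectorSpan ℝ K) = d := by
  have h1 : affineSpan ℝ K = ⊤ := by
    rw [← hK.convex.interior_nonempty_iff_affineSpan_eq_top]
    exact hK.interior_nonempty
  rw [← direction_affineSpan, h1, AffineSubspace.direction_top, finrank_top,
    finrank_euclideanSpace_fin]

theorem IsConvexBody.nonempty {K : Set (E d)} (hK : IsConvexBody K) : K.Nonempty :=
  hK.interior_nonempty.mono interior_subset

theorem IsConvexBody.span_hom_image {K : Set (E d)} (hK : IsConvexBody K) :
    span ℝ (hom '' K) = ⊤ := by
  apply Submodule.eq_top_of_finrank_eq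
  rw [finrank_span_hom_image hK.nonempty, hK.finrank_vectorSpan]
  simp

/-- A face is the intersection of the body with the span of the face, hence closed. -/
theorem isCompact_hom_image_of_isFace {K F : Set (E d)} (hK : IsCompact K) (hF : IsFace K F)
    (hne : F.Nonempty) : IsCompact (hom '' F) := by
  have h1 : hom '' F = hom '' K ∩ span ℝ (hom '' F) := by
    refine Subset.antisymm (fun x hx => ⟨image_mono hF.isExtreme.subset hx, subset_span hx⟩) ?_
    rintro x ⟨hx1, hx2⟩
    exact mem_of_isExtreme_of_mem_span snd_hom_image (convex_hom_image hF.convex)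
      (hne.image _) (isExtreme_hom_image hF.isExtreme) hx1 hx2
  rw [h1]
  exact (hK.image continuous_hom).inter_right (Submodule.closed_of_finiteDimensional _)

/-- The planar face costs three vectors and each dimension one more, including the last step from
the facet `F (d - 1)` to `K`. -/
theorem coneLit_of_partialFlag (hd : 2 < d) {K : Set (E d)} (hK : IsConvexBody K)
    {F : ℕ → Set (E d)} (hF : IsPartialFlag K 2 F) : ConeLit (hom '' K) (d + 1) := by
  have hcompact : ∀ i, 2 ≤ i → i < d → IsCompact (hom '' F i) := fun i h1 h2 =>
    isCompact_hom_image_of_isFace hK.isCompact (hF.isFace i h1 h2) (hF.hasDim i h1 h2).1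
  have hdim : ∀ i, 2 ≤ i → i < d → Module.finrank ℝ (span ℝ (hom '' F i)) = i + 1 :=
    fun i h1 h2 => by rw [finrank_span_hom_image (hF.hasDim i h1 h2).1, (hF.hasDim i h1 h2).2]
  have hchain : ∀ i, 2 ≤ i → i < d → ConeLit (hom '' F i) (i + 1) := by
    intro i hi
    induction i, hi using Nat.le_induction with
    | base =>
      intro h2
      exact coneLit_of_finrank_span_eq_three snd_hom_image
        (convex_hom_image (hF.isFace 2 le_rfl h2).convex) (hcompact 2 le_rfl h2)
        ((hF.hasDim 2 le_rfl h2).1.image _) (hdim 2 le_rfl h2)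
    | succ i hi ih =>
      intro h2
      have hi' : i < d := by omega
      have hi2 : 2 ≤ i + 1 := by omega
      refine ConeLit.succ_of_isExtreme snd_hom_image (convex_hom_image (hF.isFace i hi hi').convex)
        ((hF.hasDim i hi hi').1.image _) (convex_hom_image (hF.isFace (i + 1) hi2 h2).convex)
        (hcompact _ hi2 h2) (isExtreme_hom_image ?_)
        (by rw [hdim _ hi2 h2, hdim _ hi hi']) (ih hi')
      exact (hF.isFace i hi hi').isExtreme.mono (hF.isFace (i + 1) hi2 h2).isExtreme.subset
        (hF.ssubset i hi h2).subset
  have h1 : 2 ≤ d - 1 := by omega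
  have h2 : d - 1 < d := by omega
  have h3 := hchain (d - 1) h1 h2
  have h4 : d - 1 + 1 = d := by omega
  rw [h4] at h3
  refine ConeLit.succ_of_isExtreme snd_hom_image (convex_hom_image (hF.isFace _ h1 h2).convex)
    ((hF.hasDim _ h1 h2).1.image _) (convex_hom_image hK.convex)
    (hK.isCompact.image continuous_hom) (isExtreme_hom_image (hF.isFace _ h1 h2).isExtreme) ?_ h3
  rw [finrank_span_hom_image hK.nonempty, hK.finrank_vectorSpan, hdim _ h1 h2, h4]

theorem coneLit_of_polytope {P : Set (E d)} (hP : IsConvexPolytope P) :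
    ConeLit (hom '' P) (d + 1) := by
  obtain ⟨S, hS, rfl⟩ := hP.exists_finite
  rw [hom_image_convexHull]
  refine coneLit_convexHull d (hS.image _) snd_hom_image ?_
  rw [← span_convexHull_eq, ← hom_image_convexHull,
    finrank_span_hom_image hP.isConvexBody.nonempty, hP.isConvexBody.finrank_vectorSpan]

end Homogenization

/-! ### Projective maps and combinatorial equivalence. -/

section Projective

variable {d : ℕ}

/-- The inverse of `e` maps open segments between points of the image to open segments. -/
def ReflectsSegments (e : OpenPartialHomeomorph (E d) (E d)) : Prop :=
  ∀ x ∈ e.source, ∀ y ∈ e.source, ∀ z ∈ openSegment ℝ (e x) (e y),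
    z ∈ e.target ∧ e.symm z ∈ openSegment ℝ x y

variable {e : OpenPartialHomeomorph (E d) (E d)} {K F : Set (E d)}

theorem ReflectsSegments.convex_image (he : ReflectsSegments e) (hK : K ⊆ e.source)
    (hc : Convex ℝ K) : Convex ℝ (e '' K) := by
  rw [convex_iff_openSegment_subset]
  rintro _ ⟨x, hx, rfl⟩ _ ⟨y, hy, rfl⟩ z hz
  obtain ⟨h1, h2⟩ := he x (hK hx) y (hK hy) z hz
  exact ⟨e.symm z, hc.openSegment_subset hx hy h2, e.right_inv h1⟩

theorem ReflectsSegments.isFace_image (he : ReflectsSegments e) (hK : K ⊆ e.source)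
    (hF : IsFace K F) : IsFace (e '' K) (e '' F) := by
  refine ⟨he.convex_image (hF.isExtreme.subset.trans hK) hF.convex,
    image_mono hF.isExtreme.subset, ?_⟩
  rintro _ ⟨x, hx, rfl⟩ _ ⟨y, hy, rfl⟩ _ ⟨z, hz, rfl⟩ hseg
  obtain ⟨_, h2⟩ := he x (hK hx) y (hK hy) _ hseg
  rw [e.left_inv (hK (hF.isExtreme.subset hz))] at h2
  exact ⟨x, hF.isExtreme.left_mem_of_mem_openSegment hx hy hz h2, rfl⟩

theorem interior_image_of_subset_source (e : OpenPartialHomeomorph (E d) (E d))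
    (hK : K ⊆ e.source) : interior (e '' K) = e '' interior K := by
  refine Subset.antisymm ?_ (interior_maximal (image_mono interior_subset)
    (e.isOpen_image_of_subset_source isOpen_interior (interior_subset.trans hK)))
  have hKt : e '' K ⊆ e.target := by
    rintro _ ⟨x, hx, rfl⟩; exact e.map_source (hK hx)
  have h1 : e.symm '' interior (e '' K) ⊆ interior K := by
    refine interior_maximal ?_ (e.symm.isOpen_image_of_subset_source isOpen_interior
      (interior_subset.trans hKt))
    rintro _ ⟨_, hy, rfl⟩
    obtain ⟨x, hx, rfl⟩ := interior_subset hy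
    rwa [e.left_inv (hK hx)]
  intro y hy
  exact ⟨e.symm y, h1 ⟨y, hy, rfl⟩, e.right_inv (hKt (interior_subset hy))⟩

theorem isConvexBody_image (he : ReflectsSegments e) (hK : IsConvexBody K) (hs : K ⊆ e.source) :
    IsConvexBody (e '' K) where
  convex := he.convex_image hs hK.convex
  isCompact := hK.isCompact.image_of_continuousOn (e.continuousOn.mono hs)
  interior_nonempty := by
    rw [interior_image_of_subset_source e hs]
    exact hK.interior_nonempty.image e

theorem IsConvexBody.frontier_eq (hK : IsConvexBody K) : frontier K = K \ interior K :=
  hK.isCompact.isClosed.frontier_eq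

theorem image_frontier (he : ReflectsSegments e) (hK : IsConvexBody K) (hs : K ⊆ e.source) :
    e '' frontier K = frontier (e '' K) := by
  rw [hK.frontier_eq, (isConvexBody_image he hK hs).frontier_eq,
    interior_image_of_subset_source e hs]
  exact (e.injOn.mono hs).image_sdiff_subset interior_subset

theorem combinatoriallyEquivalent_image (he : ReflectsSegments e) (he' : ReflectsSegments e.symm)
    (hK : IsConvexBody K) (hs : K ⊆ e.source) : CombinatoriallyEquivalent K (e '' K) := by
  have hfr : frontier K ⊆ e.source := (hK.isCompact.isClosed.frontier_subset).trans hs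
  refine ⟨e.homeomorphOfImageSubsetSource hfr (image_frontier he hK hs), fun X => ?_⟩
  have h1 : Subtype.val '' (e.homeomorphOfImageSubsetSource hfr (image_frontier he hK hs) '' X) =
      e '' (Subtype.val '' X) := by
    rw [image_image, image_image]
    rfl
  rw [h1]
  refine ⟨he.isFace_image hs, fun h => ?_⟩
  have hXs : Subtype.val '' X ⊆ e.source := by
    rintro _ ⟨x, _, rfl⟩; exact hfr x.2
  have h2 := he'.isFace_image (K := e '' K) (by
    rintro _ ⟨x, hx, rfl⟩; exact e.map_source (hs hx)) h
  have hinv : ∀ A ⊆ e.source, e.symm '' (e '' A) = A := fun A hA =>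
    e.symm_image_image_of_subset_source hA
  rwa [hinv _ hs, hinv _ hXs] at h2

/-- The projective map `x ↦ (x - x₀) / (1 + φ (x - x₀))`. -/
noncomputable def projMap (φ : E d →L[ℝ] ℝ) (x₀ : E d) : OpenPartialHomeomorph (E d) (E d) where
  toFun x := (1 + φ (x - x₀))⁻¹ • (x - x₀)
  invFun y := x₀ + (1 - φ y)⁻¹ • y
  source := {x | 0 < 1 + φ (x - x₀)}
  target := {y | 0 < 1 - φ y}
  map_source' := by
    intro x (hx : 0 < 1 + φ (x - x₀))
    have : 1 - φ ((1 + φ (x - x₀))⁻¹ • (x - x₀)) = (1 + φ (x - x₀))⁻¹ := by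
      rw [map_smul, smul_eq_mul]; field_simp; ring
    show 0 < 1 - φ ((1 + φ (x - x₀))⁻¹ • (x - x₀))
    rw [this]; positivity
  map_target' := by
    intro y (hy : 0 < 1 - φ y)
    have : 1 + φ (x₀ + (1 - φ y)⁻¹ • y - x₀) = (1 - φ y)⁻¹ := by
      rw [add_sub_cancel_left, map_smul, smul_eq_mul]; field_simp; ring
    show 0 < 1 + φ (x₀ + (1 - φ y)⁻¹ • y - x₀)
    rw [this]; positivity
  left_inv' := by
    intro x (hx : 0 < 1 + φ (x - x₀))
    have : 1 - φ ((1 + φ (x - x₀))⁻¹ • (x - x₀)) = (1 + φ (x - x₀))⁻¹ := by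
      rw [map_smul, smul_eq_mul]; field_simp; ring
    rw [this, inv_inv, smul_inv_smul₀ hx.ne', add_sub_cancel]
  right_inv' := by
    intro y (hy : 0 < 1 - φ y)
    have : 1 + φ (x₀ + (1 - φ y)⁻¹ • y - x₀) = (1 - φ y)⁻¹ := by
      rw [add_sub_cancel_left, map_smul, smul_eq_mul]; field_simp; ring
    rw [this, inv_inv, add_sub_cancel_left, smul_inv_smul₀ hy.ne']
  open_source := isOpen_lt continuous_const (by fun_prop)
  open_target := isOpen_lt continuous_const (by fun_prop)
  continuousOn_toFun := by
    have h1 : Continuous fun x => 1 + φ (x - x₀) := by fun_prop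
    have h2 : Continuous fun x : E d => x - x₀ := by fun_prop
    exact (h1.continuousOn.inv₀ fun x (hx : 0 < 1 + φ (x - x₀)) => hx.ne').smul h2.continuousOn
  continuousOn_invFun := by
    have h1 : Continuous fun y => 1 - φ y := by fun_prop
    exact continuousOn_const.add
      ((h1.continuousOn.inv₀ fun y (hy : 0 < 1 - φ y) => hy.ne').smul continuousOn_id)

theorem reflectsSegments_projMap (φ : E d →L[ℝ] ℝ) (x₀ : E d) :
    ReflectsSegments (projMap φ x₀) := by
  rintro x (hx : 0 < 1 + φ (x - x₀)) y (hy : 0 < 1 + φ (y - x₀)) _ ⟨a, b, ha, hb, hab, rfl⟩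
  set A := 1 + φ (x - x₀) with hA
  set B := 1 + φ (y - x₀) with hB
  have hm : 1 - φ (a • projMap φ x₀ x + b • projMap φ x₀ y) = a / A + b / B := by
    have h1 : φ (x - x₀) = A - 1 := by rw [hA]; ring
    have h2 : φ (y - x₀) = B - 1 := by rw [hB]; ring
    have : φ (a • projMap φ x₀ x + b • projMap φ x₀ y) =
        a * (A⁻¹ * φ (x - x₀)) + b * (B⁻¹ * φ (y - x₀)) := by
      rw [map_add, map_smul, map_smul]
      show a • φ (A⁻¹ • (x - x₀)) + b • φ (B⁻¹ • (y - x₀)) = _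
      simp only [map_smul, smul_eq_mul]
    rw [this, h1, h2]
    field_simp
    linear_combination (-(A * B)) * hab
  have hm0 : 0 < a / A + b / B := by positivity
  refine ⟨?_, a / A / (a / A + b / B), b / B / (a / A + b / B), by positivity, by positivity,
    by rw [← add_div, div_self hm0.ne'], ?_⟩
  · show 0 < 1 - φ (a • projMap φ x₀ x + b • projMap φ x₀ y)
    rw [hm]; exact hm0
  · show _ = x₀ + (1 - φ (a • projMap φ x₀ x + b • projMap φ x₀ y))⁻¹ •
      (a • A⁻¹ • (x - x₀) + b • B⁻¹ • (y - x₀))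
    rw [hm]
    have h1 : a / A / (a / A + b / B) + b / B / (a / A + b / B) - 1 = 0 := by
      rw [← add_div, div_self hm0.ne', sub_self]
    rw [← sub_eq_zero]
    refine Eq.trans (b := (a / A / (a / A + b / B) + b / B / (a / A + b / B) - 1) • x₀) ?_ ?_
    · module
    · rw [h1, zero_smul]

theorem reflectsSegments_projMap_symm (φ : E d →L[ℝ] ℝ) (x₀ : E d) :
    ReflectsSegments (projMap φ x₀).symm := by
  rintro x (hx : 0 < 1 - φ x) y (hy : 0 < 1 - φ y) _ ⟨a, b, ha, hb, hab, rfl⟩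
  set A := 1 - φ x with hA
  set B := 1 - φ y with hB
  have hz : a • (projMap φ x₀).symm x + b • (projMap φ x₀).symm y - x₀ =
      (a / A) • x + (b / B) • y := by
    show a • (x₀ + A⁻¹ • x) + b • (x₀ + B⁻¹ • y) - x₀ = _
    have : x₀ = (a + b) • x₀ := by rw [hab, one_smul]
    nth_rewrite 3 [this]
    module
  have hm : 1 + φ (a • (projMap φ x₀).symm x + b • (projMap φ x₀).symm y - x₀) =
      a / A + b / B := by
    have h1 : φ x = 1 - A := by rw [hA]; ring
    have h2 : φ y = 1 - B := by rw [hB]; ring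
    rw [hz, map_add, map_smul, map_smul, smul_eq_mul, smul_eq_mul, h1, h2]
    field_simp
    linear_combination (-(A * B)) * hab
  have hm0 : 0 < a / A + b / B := by positivity
  refine ⟨?_, a / A / (a / A + b / B), b / B / (a / A + b / B), by positivity, by positivity,
    by rw [← add_div, div_self hm0.ne'], ?_⟩
  · show 0 < 1 + φ (a • (projMap φ x₀).symm x + b • (projMap φ x₀).symm y - x₀)
    rw [hm]; exact hm0
  · show _ = (1 + φ (a • (projMap φ x₀).symm x + b • (projMap φ x₀).symm y - x₀))⁻¹ •
      (a • (projMap φ x₀).symm x + b • (projMap φ x₀).symm y - x₀)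
    rw [hm, hz]
    module

/-- If the cone over `K` can be lit by `n` vectors, then a projective image of `K` is illuminated
by at most `n` directions. -/
theorem exists_illuminates_of_coneLit {n : ℕ} (hK : IsConvexBody K) (h : ConeLit (hom '' K) n) :
    ∃ K' : Set (E d), IsConvexBody K' ∧ CombinatoriallyEquivalent K K' ∧
      ∃ S : Finset (E d), S.card ≤ n ∧ Illuminates S K' := by
  classical
  obtain ⟨l, W, hWn, hl, hW, hlit⟩ := h
  have hconv := convex_hom_image hK.convex
  obtain ⟨_, ⟨x₀, hx₀, rfl⟩, hg⟩ := exists_coneInt hconv (hK.nonempty.image hom)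
  have hl₀ : 0 < l (hom x₀) := hl _ ⟨x₀, hx₀, rfl⟩
  -- normalize `l`
  let m : E d × ℝ →ₗ[ℝ] ℝ := (l (hom x₀))⁻¹ • l
  have hm₀ : m (hom x₀) = 1 := by simp [m, hl₀.ne']
  have hmK : ∀ x ∈ K, 0 < m (hom x) := fun x hx => by
    simpa [m] using mul_pos (inv_pos.2 hl₀) (hl _ ⟨x, hx, rfl⟩)
  have hmW : ∀ w ∈ W, m w < 0 := fun w hw => by
    simpa [m] using mul_neg_of_pos_of_neg (inv_pos.2 hl₀) (hW w hw).2
  let φ : E d →L[ℝ] ℝ := LinearMap.toContinuousLinearMap (m ∘ₗ LinearMap.inl ℝ (E d) ℝ)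
  have hφ : ∀ x, φ x = m (x, 0) := fun x => rfl
  have hmφ : ∀ x, 1 + φ (x - x₀) = m (hom x) := by
    intro x
    rw [hφ, ← hm₀, ← map_add]
    congr 1
    ext <;> simp [hom]
  have hsource : K ⊆ (projMap φ x₀).source := fun x hx => by
    show 0 < 1 + φ (x - x₀)
    rw [hmφ]; exact hmK x hx
  have hproj : ∀ x, projMap φ x₀ x = (m (hom x))⁻¹ • (x - x₀) := fun x => by
    rw [← hmφ]; rfl
  have he := reflectsSegments_projMap φ x₀
  have hK' := isConvexBody_image he hK hsource
  let dir : E d × ℝ → E d := fun w => (w - m w • hom x₀).1 - (w - m w • hom x₀).2 • x₀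
  -- lighting of the image in terms of lighting of the cone
  have hlight : ∀ p ∈ K, ∃ w ∈ W, ∃ t : ℝ, 0 < t ∧
      projMap φ x₀ p + t • dir w ∈ interior (projMap φ x₀ '' K) := by
    intro p hp
    obtain ⟨w, hw, t, ht, hi⟩ := hlit _ ⟨p, hp, rfl⟩
    -- Since `m w < 0`, the correction is a positive multiple of `hom x₀`: it keeps the point
    -- interior and moves the displacement into the kernel of `m`.
    have hi' : ConeInt (hom '' K) (hom p + t • (w - m w • hom x₀)) := by
      have h1 : 0 < -(t * m w) := by
        have := mul_neg_of_pos_of_neg ht (hmW w hw)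
        linarith
      have := hi.add hconv (smul_mem_posCone h1 (subset_posCone ⟨x₀, hx₀, rfl⟩))
      convert this using 1
      module
    have hm0 : m (w - m w • hom x₀) = 0 := by simp [hm₀]
    generalize hw' : w - m w • hom x₀ = w' at hi' hm0
    obtain ⟨c, hc, _, ⟨k, hk, rfl⟩, hck⟩ := hi'.mem_posCone
    have hkint : k ∈ interior K := by
      rw [mem_interior_iff_mem_nhds]
      have h1 := hi'.2
      rw [hK.span_hom_image, Submodule.top_coe, nhdsWithin_univ, hck] at h1
      have h2 : Continuous fun x : E d => c • hom x := continuous_hom.const_smul c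
      filter_upwards [h2.continuousAt.eventually h1] with x hx
      obtain ⟨a, ha, _, ⟨y, hy, rfl⟩, hay⟩ := hx
      have h3 : c = a := by simpa using congrArg Prod.snd hay
      have h4 : c • x = a • y := congrArg Prod.fst hay
      rw [← h3] at h4
      rwa [smul_right_injective _ hc.ne' h4]
    refine ⟨w, hw, (m (hom p))⁻¹ * t, mul_pos (inv_pos.2 (hmK p hp)) ht, ?_⟩
    rw [interior_image_of_subset_source _ hsource]
    refine ⟨k, hkint, ?_⟩
    have h5 : m (hom p) = c * m (hom k) := by
      have := congrArg m hck
      simpa [hm0] using this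
    have h6 : 1 + t * w'.2 = c := by simpa using congrArg Prod.snd hck
    have h7 : p + t • w'.1 = c • k := by simpa using congrArg Prod.fst hck
    have hmk := hmK k (interior_subset hkint)
    have h8 : c • (k - x₀) = (p - x₀) + t • (w'.1 - w'.2 • x₀) := by
      rw [smul_sub, ← h7, ← h6]
      module
    rw [hproj, hproj, mul_smul, ← smul_add]
    simp only [dir, hw']
    rw [← h8, h5, smul_smul]
    congr 1
    field_simp
  refine ⟨projMap φ x₀ '' K, hK', combinatoriallyEquivalent_image he
    (reflectsSegments_projMap_symm φ x₀) hK hsource,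
    -- A zero displacement lights no boundary point, so zeros are discarded before normalizing.
    ((W.image dir).filter (· ≠ 0)).image (fun v => ‖v‖⁻¹ • v), ?_, ?_, ?_⟩
  · exact Finset.card_image_le.trans ((Finset.card_filter_le _ _).trans
      (Finset.card_image_le.trans hWn))
  · intro v hv
    obtain ⟨u, hu, rfl⟩ := Finset.mem_image.1 hv
    have hu0 := (Finset.mem_filter.1 hu).2
    rw [norm_smul, norm_inv, norm_norm, inv_mul_cancel₀ (norm_ne_zero_iff.2 hu0)]
  · intro q hq
    rw [← image_frontier he hK hsource] at hq
    obtain ⟨p, hp, rfl⟩ := hq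
    have hpK := hK.isCompact.isClosed.frontier_subset hp
    obtain ⟨w, hw, t, ht, hi⟩ := hlight p hpK
    have hdir : dir w ≠ 0 := by
      intro h0
      rw [h0, smul_zero, add_zero] at hi
      have h1 : projMap φ x₀ p ∈ frontier (projMap φ x₀ '' K) := by
        rw [← image_frontier he hK hsource]; exact ⟨p, hp, rfl⟩
      exact h1.2 hi
    refine ⟨‖dir w‖⁻¹ • dir w, Finset.mem_image_of_mem _ (Finset.mem_filter.2
      ⟨Finset.mem_image_of_mem _ hw, hdir⟩), t * ‖dir w‖, by positivity, ?_⟩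
    rwa [mul_smul, smul_inv_smul₀ (norm_ne_zero_iff.2 hdir)]

end Projective

/-! ### At least `d + 1` directions. -/

section LowerBound

variable {d : ℕ}

/-- A family of at most `d` vectors lies in a closed half-space. -/
theorem exists_nonneg_functional (hd : 0 < d) {S : Finset (E d)} (hS : S.card ≤ d) :
    ∃ u : E d →ₗ[ℝ] ℝ, u ≠ 0 ∧ ∀ v ∈ S, 0 ≤ u v := by
  classical
  -- If the vectors span, they form a basis and the sum of the coordinate functionals is `1` on
  -- each; otherwise some nonzero functional vanishes on all of them.
  by_cases hspan : span ℝ (S : Set (E d)) = ⊤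
  · have hfr : Module.finrank ℝ (span ℝ (S : Set (E d))) = d := by
      rw [hspan, finrank_top, finrank_euclideanSpace_fin]
    have hcard : Fintype.card S = Set.finrank ℝ (range ((↑) : S → E d)) := by
      rw [Fintype.card_coe, Set.finrank, Subtype.range_coe_subtype]
      have h1 := finrank_span_finset_le_card (R := ℝ) S
      rw [Set.finrank] at h1
      have h2 : {x | x ∈ S} = (S : Set (E d)) := rfl
      rw [h2]
      omega
    have hli : LinearIndependent ℝ ((↑) : S → E d) :=
      linearIndependent_iff_card_eq_finrank_span.2 hcard
    obtain ⟨c, hc, _⟩ := exists_coordinates hli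
    have hne : S.Nonempty := by
      rw [Finset.nonempty_iff_ne_empty]
      rintro rfl
      rw [Finset.coe_empty, span_empty, finrank_bot] at hfr
      omega
    have hval : ∀ v (hv : v ∈ S), (∑ i, c i) v = 1 := by
      intro v hv
      rw [LinearMap.sum_apply]
      have : ∀ i, c i v = if i = ⟨v, hv⟩ then 1 else 0 := fun i => hc i ⟨v, hv⟩
      simp [this]
    refine ⟨∑ i, c i, ?_, fun v hv => by rw [hval v hv]; exact zero_le_one⟩
    obtain ⟨v, hv⟩ := hne
    intro h0
    have := hval v hv
    rw [h0] at this
    simp at this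
  · obtain ⟨x, hx⟩ : ∃ x, x ∉ span ℝ (S : Set (E d)) := by
      by_contra! hcon
      exact hspan (eq_top_iff.2 fun x _ => hcon x)
    obtain ⟨u, hu, hle⟩ := Submodule.exists_le_ker_of_notMem hx
    exact ⟨u, by rintro rfl; exact hu rfl, fun v hv => (hle (subset_span hv)).ge⟩

theorem lt_card_of_illuminates (hd : 0 < d) {K : Set (E d)} (hK : IsConvexBody K)
    {S : Finset (E d)} (hS : Illuminates S K) : d < S.card := by
  by_contra! hcard
  obtain ⟨u, hu0, hu⟩ := exists_nonneg_functional hd hcard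
  obtain ⟨p, hp, hmax⟩ := hK.isCompact.exists_isMaxOn hK.nonempty
    (continuous_dual u).continuousOn
  -- A nonzero functional has no maximum at an interior point: one can move a little in a direction
  -- where it increases.
  have hint : ∀ q ∈ interior K, u q < u p := by
    intro q hq
    obtain ⟨w, hw⟩ : ∃ w, 0 < u w := by
      obtain ⟨w, hw⟩ : ∃ w, u w ≠ 0 := by
        by_contra! hcon
        exact hu0 (LinearMap.ext hcon)
      rcases lt_or_gt_of_ne hw with h | h
      · exact ⟨-w, by simpa using h⟩
      · exact ⟨w, h⟩
    have h1 : ∀ᶠ t in 𝓝[>] (0 : ℝ), q + t • w ∈ K := by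
      have hcont : ContinuousAt (fun t : ℝ => q + t • w) 0 := by fun_prop
      exact mem_nhdsWithin_of_mem_nhds (hcont.eventually (by
        simpa using mem_interior_iff_mem_nhds.1 hq))
    obtain ⟨t, ht, ht0⟩ := (h1.and self_mem_nhdsWithin).exists
    have h2 : u (q + t • w) ≤ u p := hmax ht
    rw [map_add, map_smul, smul_eq_mul] at h2
    have := mul_pos (show 0 < t from ht0) hw
    linarith
  have hpf : p ∈ frontier K := by
    rw [hK.frontier_eq]
    exact ⟨hp, fun h => lt_irrefl _ (hint p h)⟩
  obtain ⟨v, hv, t, ht, hi⟩ := hS.2 p hpf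
  have h1 := hint _ hi
  rw [map_add, map_smul, smul_eq_mul] at h1
  have := mul_nonneg ht (hu v hv)
  linarith

theorem combIlluminationNumber_eq_of_coneLit (hd : 0 < d) {K : Set (E d)} (hK : IsConvexBody K)
    (h : ConeLit (hom '' K) (d + 1)) : combIlluminationNumber K = d + 1 := by
  obtain ⟨K', hK', hequiv, S, hcard, hS⟩ := exists_illuminates_of_coneLit hK h
  have h1 := lt_card_of_illuminates hd hK' hS
  refine le_antisymm (Nat.sInf_le ⟨K', hK', hequiv, S, by omega, hS⟩) ?_
  refine le_csInf ⟨_, K', hK', hequiv, S, rfl, hS⟩ ?_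
  rintro _ ⟨L, hL, _, T, rfl, hT⟩
  exact lt_card_of_illuminates hd hL hT

end LowerBound

end CombIllum

theorem mainTheorem2 (d : ℕ) (hd : 2 < d) :
    (∀ K : Set (CombIllum.E d), CombIllum.IsConvexBody K →
      CombIllum.BoundaryContainsPartialFlag K (d - 2) →
        CombIllum.combIlluminationNumber K = d + 1) ∧
    (∀ P : Set (CombIllum.E d), CombIllum.IsConvexPolytope P →
      CombIllum.combIlluminationNumber P = d + 1) := by
  refine ⟨fun K hK ⟨s, F, hs, hF, _⟩ => ?_, fun P hP => ?_⟩
  · obtain rfl : s = 2 := by omega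
    exact CombIllum.combIlluminationNumber_eq_of_coneLit (by omega) hK
      (CombIllum.coneLit_of_partialFlag hd hK hF)
  · exact CombIllum.combIlluminationNumber_eq_of_coneLit (by omega) hP.isConvexBody
      (CombIllum.coneLit_of_polytope hP)
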